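/- Let $M\ge 1$ be an integer, $\mathbb{Z}_M=\mathbb{Z}/M\mathbb{Z}$ and $\gamma\in\mathbb{R}$. For $u\in\mathbb{R}^{\mathbb{Z}_M}$ and $j\in\mathbb{Z}_M$ set $$\Delta u_j=u_{j+1}+u_{j-1}-2u_j,\qquad w_j=\tfrac13\left(u_j^2+u_ju_{j+1}+u_{j+1}^2\right),\qquad B_j(u)=w_j-w_{j-1}.$$ The periodic Sasamoto–Spohn dynamics is the system of stochastic differential equations $$du_j=\left(\tfrac12\Delta u_j+\gamma B_j(u)\right)dt+d\xi_j-d\xi_{j-1},\qquad j\in\mathbb{Z}_M,$$ where $(\xi_j)_{j\in\mathbb{Z}_M}$ is an i.i.d. family of standard one-dimensional Brownian motions. A solution with initial value $X_0$ is a process $(u(t))_{t\ge0}$ with values in $\mathbb{R}^{\mathbb{Z}_M}$ and almost surely continuous paths such that, almost surely, for all $t\ge 0$ and $j\in\mathbb{Z}_M$, $$u_j(t)=X_{0,j}+\int_0^t\left(\tfrac12\Delta u_j(s)+\gamma B_j(u(s))\right)ds+\xi_j(t)-\xi_{j-1}(t).$$ Let $\mu_M=\rho^{\otimes\mathbb{Z}_M}$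 with $d\rho(x)=\frac{1}{\sqrt{2\pi}}e^{-x^2/2}\,dx$ be the product standard Gaussian measure on $\mathbb{R}^{\mathbb{Z}_M}$. Then $\mu_M$ is invariant for this dynamics: on any probability space carrying such a family $(\xi_j)_{j\in\mathbb{Z}_M}$ and a random variable $X_0$ with law $\mu_M$ that is independent of $(\xi_j)_{j\in\mathbb{Z}_M}$, there is a solution defined for all times $t\ge0$ with initial value $X_0$, and for every such solution $u$ and every $t\ge0$ the random variable $u(t)$ has law $\mu_M$. -/

import Mathlib

open MeasureTheory ProbabilityTheory
open scoped NNReal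

namespace SasamotoSpohn

/-- The discrete Laplacian on `ℤ / Mℤ`: `Δ u_j = u_{j+1} + u_{j-1} - 2 u_j`. -/
def laplacian {M : ℕ} (u : ZMod M → ℝ) (j : ZMod M) : ℝ :=
  u (j + 1) + u (j - 1) - 2 * u j

/-- `w_j = (u_j² + u_j u_{j+1} + u_{j+1}²) / 3`. -/
noncomputable def w {M : ℕ} (u : ZMod M → ℝ) (j : ZMod M) : ℝ :=
  (1 / 3) * (u j ^ 2 + u j * u (j + 1) + u (j + 1) ^ 2)

/-- The discretized Burgers nonlinearity `B_j(u) = w_j - w_{j-1}`. -/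
noncomputable def nonlinearity {M : ℕ} (u : ZMod M → ℝ) (j : ZMod M) : ℝ :=
  w u j - w u (j - 1)

/-- The drift `½ Δ u_j + γ B_j(u)`. -/
noncomputable def drift {M : ℕ} (γ : ℝ) (u : ZMod M → ℝ) (j : ZMod M) : ℝ :=
  (1 / 2) * laplacian u j + γ * nonlinearity u j

/-- The product standard Gaussian measure `μ_M = ρ^{⊗ ℤ_M}` on `ℝ^{ℤ_M}`. -/
noncomputable def gaussianMeasure (M : ℕ) [NeZero M] : Measure (ZMod M → ℝ) :=
  Measure.pi fun _ => gaussianReal 0 1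

/-- `(ξ_j)_{j ∈ ℤ_M}` is an i.i.d. family of standard one-dimensional Brownian motions. -/
structure IsNoise {M : ℕ} {Ω : Type*} [MeasurableSpace Ω] (ξ : ZMod M → ℝ≥0 → Ω → ℝ)
    (P : Measure Ω) : Prop where
  isBrownian : ∀ j, IsBrownianReal (ξ j) P
  indep : iIndepFun (fun j ω (t : ℝ≥0) => ξ j t ω) P

/-- `u` is a solution of the periodic Sasamoto-Spohn dynamics
`du_j = ½ Δ u_j dt + γ B_j(u) dt + dξ_j - dξ_{j-1}`, `j ∈ ℤ_M`, driven by `ξ` and started from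
`X₀`: a process with almost surely continuous paths which satisfies the integrated equation. -/
structure IsSolution {M : ℕ} {Ω : Type*} [MeasurableSpace Ω] (γ : ℝ)
    (ξ : ZMod M → ℝ≥0 → Ω → ℝ) (X₀ : Ω → ZMod M → ℝ) (u : ℝ≥0 → Ω → ZMod M → ℝ)
    (P : Measure Ω) : Prop where
  aemeasurable : ∀ t, AEMeasurable (u t) P
  continuous : ∀ᵐ ω ∂P, Continuous fun t => u t ω
  equation : ∀ᵐ ω ∂P, ∀ (t : ℝ≥0) (j : ZMod M),
    u t ω j = X₀ ω j + (∫ s in (0 : ℝ)..t, drift γ (u s.toNNReal ω) j)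
      + (ξ j t ω - ξ (j - 1) t ω)

end SasamotoSpohn

/-! The drift is a sum of two parts, each of which preserves the Gaussian. With the noise, `½Δ`
gives an Ornstein–Uhlenbeck process with stationary covariance the identity, since the noise `Dξ`
has covariance `-Δ` per unit time. The field `B` is divergence free and orthogonal to `x`, so its
flow preserves both Lebesgue measure and `|x|²`, hence the Gaussian density.

The two parts are combined by a splitting scheme, without generators or stochastic calculus. An
Euler step of length `h` along a compactly supported conservative field changes the Gaussian by only
`O(h²)` in total variation (`IsConservative.exists_abs_integral_euler_sub_le`): the first-order term
of the Jacobian is the divergence, and that of the density is `x ⬝ᵥ b x`. A Crank–Nicolson step with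
the exact Brownian increment preserves the Gaussian for every `h` (`map_crankNicolson`). With
independence of increments, `N` steps of length `t / N` cost `O(1 / N)`
(`abs_integral_scheme_sub_le`).

The noise is additive, so the equation can be solved path by path, and for a Lipschitz bounded field
the scheme converges pathwise to any solution (`SolvesOn.tendsto_scheme`). Since `B` is only locally
Lipschitz, it is multiplied by a radial cutoff, which keeps it conservative. A continuous solution
is bounded on `[0, t]`, so it solves the truncated equation for every large radius. Letting `N → ∞`
and then `R → ∞` identifies the law of `u t` (`integral_eq_of_eventually_tendsto`). The same
convergence yields pathwise uniqueness and measurability.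

For existence, subtracting the noise leaves an ordinary differential equation. An energy estimate,
again using that `B` is orthogonal to `x`, bounds its truncations uniformly in the radius. -/

namespace SasamotoSpohn

open Filter Topology Set
open scoped Matrix

/-! ### Summation by parts, and the conservation laws of the nonlinearity. -/

section Algebra

variable {M : ℕ}

/-- The discrete Laplacian as a continuous linear map. -/
noncomputable def laplacianL (M : ℕ) : (ZMod M → ℝ) →L[ℝ] (ZMod M → ℝ) :=
  ContinuousLinearMap.pi fun j =>
    ContinuousLinearMap.proj (R := ℝ) (φ := fun _ : ZMod M => ℝ) (j + 1)
      + ContinuousLinearMap.proj (j - 1) - (2 : ℝ) • ContinuousLinearMap.proj j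

@[simp]
lemma laplacianL_apply (x : ZMod M → ℝ) (j : ZMod M) : laplacianL M x j = laplacian x j := by
  simp [laplacianL, laplacian]

/-- The backward difference operator `(D η)_j = η_j - η_{j-1}`. -/
noncomputable def backwardDiff (M : ℕ) : (ZMod M → ℝ) →L[ℝ] (ZMod M → ℝ) :=
  ContinuousLinearMap.pi fun j =>
    ContinuousLinearMap.proj (R := ℝ) (φ := fun _ : ZMod M => ℝ) j
      - ContinuousLinearMap.proj (j - 1)

@[simp]
lemma backwardDiff_apply (x : ZMod M → ℝ) (j : ZMod M) :
    backwardDiff M x j = x j - x (j - 1) := by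
  simp [backwardDiff]

variable [NeZero M]

lemma sum_shift (f : ZMod M → ℝ) : ∑ j, f (j + 1) = ∑ j, f j :=
  Equiv.sum_comp (Equiv.addRight (1 : ZMod M)) f

lemma sum_shift_neg (f : ZMod M → ℝ) : ∑ j, f (j - 1) = ∑ j, f j :=
  Equiv.sum_comp (Equiv.subRight (1 : ZMod M)) f

lemma norm_laplacianL_le (x : ZMod M → ℝ) : ‖laplacianL M x‖ ≤ 4 * ‖x‖ := by
  rw [pi_norm_le_iff_of_nonneg (by positivity)]
  intro j
  rw [laplacianL_apply, laplacian, Real.norm_eq_abs, abs_le]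
  have h1 := abs_le.1 (norm_le_pi_norm x (j + 1))
  have h2 := abs_le.1 (norm_le_pi_norm x (j - 1))
  have h3 := abs_le.1 (norm_le_pi_norm x j)
  constructor <;> linarith

lemma dotProduct_laplacianL_comm (x y : ZMod M → ℝ) :
    x ⬝ᵥ laplacianL M y = laplacianL M x ⬝ᵥ y := by
  simp only [dotProduct, laplacianL_apply, laplacian, mul_sub, mul_add, sub_mul, add_mul,
    Finset.sum_sub_distrib, Finset.sum_add_distrib]
  have h1 := sum_shift fun j => x (j - 1) * y j
  have h2 := sum_shift fun j => x j * y (j - 1)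
  simp only [add_sub_cancel_right] at h1 h2
  rw [h1, ← h2]
  have : ∑ j, x j * (2 * y j) = ∑ j, 2 * x j * y j := Finset.sum_congr rfl fun _ _ => by ring
  rw [this]; ring

/-- Used twice: as dissipativity of `Δ`, and as the fluctuation–dissipation relation `D Dᵀ = -Δ`
that makes the Gaussian stationary for the linear part. -/
lemma dotProduct_laplacianL_self (x : ZMod M → ℝ) :
    x ⬝ᵥ laplacianL M x = -∑ j, (x j - x (j + 1)) ^ 2 := by
  have h1 := sum_shift fun j => x j * x (j - 1)
  have h2 := sum_shift fun j => x j ^ 2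
  simp only [add_sub_cancel_right] at h1 h2
  have e : ∀ j, (x j - x (j + 1)) ^ 2
      = x j ^ 2 + x (j + 1) ^ 2 - x j * x (j + 1) - x (j + 1) * x j := fun j => by ring
  have e' : ∀ j, x j * laplacianL M x j
      = x j * x (j + 1) + x j * x (j - 1) - x j ^ 2 - x j ^ 2 := fun j => by
    rw [laplacianL_apply, laplacian]; ring
  simp only [dotProduct, e, e', Finset.sum_sub_distrib, Finset.sum_add_distrib, h1, h2]
  ring

lemma dotProduct_laplacianL_self_nonpos (x : ZMod M → ℝ) : x ⬝ᵥ laplacianL M x ≤ 0 := by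
  rw [dotProduct_laplacianL_self, neg_nonpos]
  positivity

/-- After summation by parts the summand is `(x_j - x_{j+1}) w_j`, and `w` is the quotient for which
this equals `(x_j³ - x_{j+1}³) / 3`, a telescoping sum. -/
lemma dotProduct_nonlinearity_self (x : ZMod M → ℝ) : x ⬝ᵥ nonlinearity x = 0 := by
  have h1 := sum_shift fun j => x j * w x (j - 1)
  have h2 := sum_shift fun j => x j ^ 3
  simp only [add_sub_cancel_right] at h1
  simp only [dotProduct, nonlinearity, mul_sub, Finset.sum_sub_distrib]
  rw [← h1, ← Finset.sum_sub_distrib]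
  have e : ∀ j, x j * w x j - x (j + 1) * w x j = (1 / 3) * (x j ^ 3 - x (j + 1) ^ 3) :=
    fun j => by rw [w]; ring
  simp only [e, ← Finset.mul_sum, Finset.sum_sub_distrib, h2]
  ring

lemma contDiff_w (j : ZMod M) {n : WithTop ℕ∞} : ContDiff ℝ n fun u : ZMod M → ℝ => w u j := by
  unfold w; fun_prop

lemma contDiff_nonlinearity {n : WithTop ℕ∞} :
    ContDiff ℝ n (nonlinearity : (ZMod M → ℝ) → ZMod M → ℝ) := by
  rw [contDiff_pi]
  intro j
  exact (contDiff_w j).sub (contDiff_w (j - 1))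

lemma contDiff_drift (γ : ℝ) {n : WithTop ℕ∞} :
    ContDiff ℝ n (drift γ : (ZMod M → ℝ) → ZMod M → ℝ) := by
  rw [contDiff_pi]
  intro j
  have := contDiff_pi.1 (contDiff_nonlinearity (M := M) (n := n)) j
  unfold drift laplacian
  fun_prop

lemma hasFDerivAt_w (x : ZMod M → ℝ) (j : ZMod M) :
    HasFDerivAt (fun u : ZMod M → ℝ => w u j)
      ((1 / 3 : ℝ) • ((2 * x j + x (j + 1)) • ContinuousLinearMap.proj (R := ℝ) j
        + (x j + 2 * x (j + 1)) • ContinuousLinearMap.proj (R := ℝ) (φ := fun _ : ZMod M => ℝ)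
          (j + 1))) x := by
  have h (i : ZMod M) : HasFDerivAt (fun u : ZMod M → ℝ => u i)
      (ContinuousLinearMap.proj (R := ℝ) (φ := fun _ : ZMod M => ℝ) i) x := hasFDerivAt_apply i x
  refine (((h j).pow 2 |>.add ((h j).mul (h (j + 1))) |>.add ((h (j + 1)).pow 2)).const_mul
    (1 / 3 : ℝ)).congr_fderiv ?_
  ext v
  simp
  ring

/-- The trace of the derivative of a vector field on `ι → ℝ`. -/
noncomputable def divergence {ι : Type*} [Fintype ι] [DecidableEq ι]
    (b : (ι → ℝ) → ι → ℝ) (x : ι → ℝ) : ℝ :=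
  ∑ j, fderiv ℝ b x (Pi.single j 1) j

/-- The diagonal derivative of `B_j` is a multiple, independent of `j`, of `x_{j+1} - x_{j-1}`,
which sums to zero around the ring. -/
lemma divergence_nonlinearity (x : ZMod M → ℝ) : divergence nonlinearity x = 0 := by
  have hd : HasFDerivAt (nonlinearity : (ZMod M → ℝ) → ZMod M → ℝ) _ x :=
    hasFDerivAt_pi.2 fun j => (hasFDerivAt_w x j).sub (hasFDerivAt_w x (j - 1))
  rw [divergence, hd.fderiv]
  -- `δ` is `1` if `M = 1`, where a site is its own neighbour, and `0` otherwise; this avoids a case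
  -- split.
  set δ : ℝ := Pi.single (M := fun _ : ZMod M => ℝ) 0 1 1 with hδ
  have h1 (j : ZMod M) : (Pi.single j 1 : ZMod M → ℝ) (j + 1) = δ := by
    simp [hδ, Pi.single_apply]
  have h2 (j : ZMod M) : (Pi.single j 1 : ZMod M → ℝ) (j - 1) = δ := by
    simp [hδ, Pi.single_apply]
  have e : ∀ j, (ContinuousLinearMap.pi fun j =>
      ((1 / 3 : ℝ) • ((2 * x j + x (j + 1)) • ContinuousLinearMap.proj (R := ℝ) j
        + (x j + 2 * x (j + 1)) • ContinuousLinearMap.proj (R := ℝ) (φ := fun _ : ZMod M => ℝ)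
          (j + 1))) -
      ((1 / 3 : ℝ) • ((2 * x (j - 1) + x (j - 1 + 1)) • ContinuousLinearMap.proj (R := ℝ) (j - 1)
        + (x (j - 1) + 2 * x (j - 1 + 1)) •
          ContinuousLinearMap.proj (R := ℝ) (φ := fun _ : ZMod M => ℝ) (j - 1 + 1))))
      (Pi.single j 1 : ZMod M → ℝ) j
      = ((1 + 2 * δ) / 3) * (x (j + 1) - x (j - 1)) := by
    intro j
    simp [h1, h2]
    ring
  simp only [e, ← Finset.mul_sum, Finset.sum_sub_distrib, sum_shift, sum_shift_neg]
  ring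

end Algebra

/-- A compactly supported `C¹` vector field on `ι → ℝ` that is divergence free and tangent to the
spheres centred at the origin. -/
structure IsConservative {ι : Type*} [Fintype ι] [DecidableEq ι]
    (b : (ι → ℝ) → ι → ℝ) : Prop where
  contDiff : ContDiff ℝ 1 b
  hasCompactSupport : HasCompactSupport b
  dotProduct_self : ∀ x, x ⬝ᵥ b x = 0
  divergence : ∀ x, divergence b x = 0

/-! ### Radial truncation of vector fields. -/

section Cutoff

variable {ι : Type*} [Fintype ι]

/-- A smooth radial cutoff, equal to one where `x ⬝ᵥ x ≤ R`. -/
noncomputable def cutoff (R : ℝ≥0) (x : ι → ℝ) : ℝ :=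
  (⟨R + 1, R + 2, by positivity, by linarith⟩ : ContDiffBump (0 : ℝ)) (x ⬝ᵥ x)

lemma contDiff_dotProduct_self {n : WithTop ℕ∞} : ContDiff ℝ n fun x : ι → ℝ => x ⬝ᵥ x := by
  unfold dotProduct; fun_prop

lemma contDiff_cutoff (R : ℝ≥0) {n : ℕ∞} : ContDiff ℝ n (cutoff R : (ι → ℝ) → ℝ) :=
  (ContDiffBump.contDiff _).comp contDiff_dotProduct_self

lemma cutoff_nonneg (R : ℝ≥0) (x : ι → ℝ) : 0 ≤ cutoff R x := ContDiffBump.nonneg _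

lemma cutoff_le_one (R : ℝ≥0) (x : ι → ℝ) : cutoff R x ≤ 1 := ContDiffBump.le_one _

lemma dotProduct_self_nonneg' (x : ι → ℝ) : 0 ≤ x ⬝ᵥ x :=
  Finset.sum_nonneg fun _ _ => mul_self_nonneg _

lemma cutoff_eq_one {R : ℝ≥0} {x : ι → ℝ} (hx : x ⬝ᵥ x ≤ R) : cutoff R x = 1 := by
  apply ContDiffBump.one_of_mem_closedBall
  have := dotProduct_self_nonneg' x
  simp only [mem_closedBall_zero_iff, Real.norm_eq_abs, abs_of_nonneg this]
  linarith

/-- The norm on `ι → ℝ` is the sup norm, whereas the energy and the cutoff are Euclidean. -/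
lemma sq_norm_le_dotProduct_self (x : ι → ℝ) : ‖x‖ ^ 2 ≤ x ⬝ᵥ x := by
  rw [← Real.sqrt_le_sqrt_iff (dotProduct_self_nonneg' x), Real.sqrt_sq (norm_nonneg x),
    pi_norm_le_iff_of_nonneg (Real.sqrt_nonneg _)]
  intro i
  rw [Real.norm_eq_abs, ← Real.sqrt_sq_eq_abs]
  refine Real.sqrt_le_sqrt ?_
  rw [sq]
  exact Finset.single_le_sum (f := fun i => x i * x i) (fun _ _ => mul_self_nonneg _)
    (Finset.mem_univ i)

lemma hasCompactSupport_cutoff (R : ℝ≥0) : HasCompactSupport (cutoff R : (ι → ℝ) → ℝ) := by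
  refine HasCompactSupport.intro (isCompact_closedBall (0 : ι → ℝ) (R + 2)) fun x hx => ?_
  apply ContDiffBump.zero_of_le_dist
  have h := sq_norm_le_dotProduct_self x
  simp only [mem_closedBall_zero_iff, not_le] at hx
  have hR := R.2
  simp only [dist_zero_right, Real.norm_eq_abs, abs_of_nonneg (dotProduct_self_nonneg' x)]
  nlinarith [norm_nonneg x]

lemma fderiv_dotProduct_self (x v : ι → ℝ) :
    fderiv ℝ (fun x : ι → ℝ => x ⬝ᵥ x) x v = 2 * (x ⬝ᵥ v) := by
  have h (i : ι) : HasFDerivAt (fun u : ι → ℝ => u i)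
      (ContinuousLinearMap.proj (R := ℝ) (φ := fun _ : ι => ℝ) i) x := hasFDerivAt_apply i x
  have := HasFDerivAt.fun_sum (u := Finset.univ) fun i _ => (h i).fun_mul (h i)
  simp only [dotProduct] at this ⊢
  rw [this.fderiv]
  simp [Finset.mul_sum]
  exact Finset.sum_congr rfl fun _ _ => by ring

/-- The gradient of a radial function is parallel to `x`, hence orthogonal to `b x`, so the product
rule adds nothing to the divergence. -/
lemma isConservative_cutoff_smul [DecidableEq ι] (R : ℝ≥0) {b : (ι → ℝ) → ι → ℝ}
    (hb : ContDiff ℝ 1 b) (hdot : ∀ x, x ⬝ᵥ b x = 0) (hdiv : ∀ x, divergence b x = 0) :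
    IsConservative fun x => cutoff R x • b x where
  contDiff := (contDiff_cutoff R (n := 1)).smul hb
  hasCompactSupport := (hasCompactSupport_cutoff R).smul_right
  dotProduct_self x := by rw [dotProduct_smul, hdot, smul_zero]
  divergence x := by
    set χ : ContDiffBump (0 : ℝ) := ⟨R + 1, R + 2, by positivity, by linarith⟩ with hχ
    have h1 : DifferentiableAt ℝ χ (x ⬝ᵥ x) :=
      (χ.contDiff (n := 1)).differentiable (by simp) _
    have h2 : DifferentiableAt ℝ (fun x : ι → ℝ => x ⬝ᵥ x) x :=
      (contDiff_dotProduct_self (n := 1)).differentiable (by simp) _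
    have h3 := hb.differentiable (by simp) x
    have hc := (HasDerivAt.comp_hasFDerivAt (f := fun x : ι → ℝ => x ⬝ᵥ x) x h1.hasDerivAt
      h2.hasFDerivAt).smul h3.hasFDerivAt
    have hc' : HasFDerivAt (fun x => cutoff R x • b x) _ x := hc
    rw [divergence, hc'.fderiv]
    have e : ∀ j, x j * b x j * (2 * deriv χ (x ⬝ᵥ x))
        = (deriv χ (x ⬝ᵥ x) * (2 * x j)) * b x j := fun j => by ring
    have hdot' : ∑ j, (deriv χ (x ⬝ᵥ x) * (2 * x j)) * b x j = 0 := by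
      simp only [← e, ← Finset.sum_mul]
      rw [show ∑ j, x j * b x j = 0 from hdot x, zero_mul]
    have hdiv' := hdiv x
    rw [divergence] at hdiv'
    simp [fderiv_dotProduct_self, Finset.sum_add_distrib, ← Finset.mul_sum, hdiv']
    simpa using hdot'

end Cutoff

/-! ### Gaussian vectors and their characteristic functions. -/

section GaussianVector

variable {ι : Type*} [Fintype ι]

/-- The law of a vector of independent centred Gaussian variables of variance `v`. -/
noncomputable def gaussianVector (ι : Type*) [Fintype ι] (v : ℝ≥0) : Measure (ι → ℝ) :=
  Measure.pi fun _ => gaussianReal 0 v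

instance (v : ℝ≥0) : IsProbabilityMeasure (gaussianVector ι v) := by
  unfold gaussianVector; infer_instance

lemma integral_cexp_gaussianVector (v : ℝ≥0) (a : ι → ℝ) :
    ∫ x, Complex.exp ((x ⬝ᵥ a : ℝ) * Complex.I) ∂gaussianVector ι v
      = Complex.exp (-(v * (a ⬝ᵥ a) / 2 : ℝ)) := by
  have h (x : ι → ℝ) : Complex.exp ((x ⬝ᵥ a : ℝ) * Complex.I)
      = ∏ i, Complex.exp (a i * x i * Complex.I) := by
    rw [← Complex.exp_sum, dotProduct]
    push_cast
    rw [Finset.sum_mul]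
    exact congrArg _ (Finset.sum_congr rfl fun _ _ => by ring)
  simp_rw [h]
  rw [gaussianVector,
    integral_fintype_prod_eq_prod (𝕜 := ℂ) fun i (y : ℝ) => Complex.exp (a i * y * Complex.I)]
  simp_rw [← charFun_apply_real, charFun_gaussianReal, ← Complex.exp_sum]
  congr 1
  simp only [dotProduct, Finset.mul_sum, Finset.sum_div]
  push_cast
  rw [← Finset.sum_neg_distrib]
  exact Finset.sum_congr rfl fun _ _ => by ring

/-- Finite measures on `ι → ℝ` with the same characteristic function are equal. -/
lemma ext_of_integral_cexp_dotProduct {μ ν : Measure (ι → ℝ)} [IsFiniteMeasure μ]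
    [IsFiniteMeasure ν]
    (h : ∀ a : ι → ℝ, ∫ x, Complex.exp ((x ⬝ᵥ a : ℝ) * Complex.I) ∂μ
      = ∫ x, Complex.exp ((x ⬝ᵥ a : ℝ) * Complex.I) ∂ν) : μ = ν := by
  classical
  refine Measure.ext_of_charFunDual (funext fun L => ?_)
  obtain ⟨a, hL⟩ : ∃ a : ι → ℝ, ∀ x, L x = x ⬝ᵥ a :=
    ⟨_, LinearMap.pi_apply_eq_sum_univ L.toLinearMap⟩
  simp only [charFunDual_apply, hL, h]

end GaussianVector

/-! ### The linear stochastic step and its exact invariance. -/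

section CrankNicolson

variable {M : ℕ} [NeZero M]

lemma injective_one_sub_laplacianL (h : ℝ≥0) :
    Function.Injective ((1 : (ZMod M → ℝ) →ₗ[ℝ] (ZMod M → ℝ))
      - (h / 4 : ℝ) • (laplacianL M).toLinearMap) := by
  rw [injective_iff_map_eq_zero]
  intro x hx
  have h1 : x ⬝ᵥ (x - (h / 4 : ℝ) • laplacianL M x) = 0 := by
    have : x - (h / 4 : ℝ) • laplacianL M x = 0 := by simpa using hx
    rw [this, dotProduct_zero]
  rw [dotProduct_sub, dotProduct_smul, smul_eq_mul] at h1
  have h2 := dotProduct_laplacianL_self_nonpos x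
  have h3 := dotProduct_self_nonneg' x
  have h4 : 0 ≤ (h / 4 : ℝ) := by positivity
  exact dotProduct_self_eq_zero.1 (le_antisymm (by nlinarith) h3)

/-- The operator `1 - (h/4) Δ`, which is invertible for `h ≥ 0`. -/
noncomputable def implicitEquiv (M : ℕ) [NeZero M] (h : ℝ≥0) :
    (ZMod M → ℝ) ≃L[ℝ] (ZMod M → ℝ) :=
  (LinearEquiv.ofInjectiveEndo _ (injective_one_sub_laplacianL (M := M) h)).toContinuousLinearEquiv

lemma implicitEquiv_apply (h : ℝ≥0) (x : ZMod M → ℝ) :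
    implicitEquiv M h x = x - (h / 4 : ℝ) • laplacianL M x := rfl

/-- One Crank-Nicolson step of length `h` for `dy = ½ Δ y dt + D dξ`, from `y` with Brownian
increment `η`. -/
noncomputable def crankNicolson (M : ℕ) [NeZero M] (h : ℝ≥0) :
    (ZMod M → ℝ) × (ZMod M → ℝ) →L[ℝ] (ZMod M → ℝ) :=
  (implicitEquiv M h).symm.toContinuousLinearMap.comp
    ((1 + (h / 4 : ℝ) • laplacianL M).comp (ContinuousLinearMap.fst ℝ _ _)
      + (backwardDiff M).comp (ContinuousLinearMap.snd ℝ _ _))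

lemma implicitEquiv_crankNicolson (h : ℝ≥0) (y η : ZMod M → ℝ) :
    implicitEquiv M h (crankNicolson M h (y, η))
      = y + (h / 4 : ℝ) • laplacianL M y + backwardDiff M η := by
  simp [crankNicolson]

lemma crankNicolson_eq (h : ℝ≥0) (y η : ZMod M → ℝ) :
    crankNicolson M h (y, η)
      = y + (h / 4 : ℝ) • laplacianL M (crankNicolson M h (y, η) + y) + backwardDiff M η := by
  have := implicitEquiv_crankNicolson h y η
  rw [implicitEquiv_apply, sub_eq_iff_eq_add] at this
  rw [map_add, smul_add]
  conv_lhs => rw [this]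
  abel

lemma dotProduct_implicitEquiv_comm (h : ℝ≥0) (x y : ZMod M → ℝ) :
    x ⬝ᵥ implicitEquiv M h y = implicitEquiv M h x ⬝ᵥ y := by
  simp only [implicitEquiv_apply, dotProduct_sub, sub_dotProduct, dotProduct_smul, smul_dotProduct,
    dotProduct_laplacianL_comm]

lemma backwardDiff_dotProduct (η κ : ZMod M → ℝ) :
    backwardDiff M η ⬝ᵥ κ = η ⬝ᵥ fun j => κ j - κ (j + 1) := by
  have h1 := sum_shift fun j => η (j - 1) * κ j
  simp only [add_sub_cancel_right] at h1
  simp only [dotProduct, backwardDiff_apply, sub_mul, mul_sub, Finset.sum_sub_distrib, h1]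

lemma crankNicolson_dotProduct (h : ℝ≥0) (y η κ : ZMod M → ℝ) :
    crankNicolson M h (y, η) ⬝ᵥ implicitEquiv M h κ
      = y ⬝ᵥ (κ + (h / 4 : ℝ) • laplacianL M κ) + η ⬝ᵥ fun j => κ j - κ (j + 1) := by
  rw [dotProduct_implicitEquiv_comm, implicitEquiv_crankNicolson, add_dotProduct,
    backwardDiff_dotProduct, add_dotProduct, dotProduct_add, smul_dotProduct, dotProduct_smul,
    dotProduct_laplacianL_comm]

/-- A Crank-Nicolson step preserves the standard Gaussian measure exactly. -/
lemma map_crankNicolson (h : ℝ≥0) :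
    ((gaussianVector (ZMod M) 1).prod (gaussianVector (ZMod M) h)).map (crankNicolson M h)
      = gaussianVector (ZMod M) 1 := by
  have : IsProbabilityMeasure (((gaussianVector (ZMod M) 1).prod
      (gaussianVector (ZMod M) h)).map (crankNicolson M h)) :=
    Measure.isProbabilityMeasure_map (by fun_prop)
  refine ext_of_integral_cexp_dotProduct fun a => ?_
  -- Frequencies are parametrised as `(1 - (h/4)Δ) κ`: by self-adjointness this cancels the inverse
  -- operator in the step.
  obtain ⟨κ, rfl⟩ := (implicitEquiv M h).surjective a
  rw [integral_map (by fun_prop)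
    (Continuous.aestronglyMeasurable (by unfold dotProduct; fun_prop))]
  have e (p : (ZMod M → ℝ) × (ZMod M → ℝ)) :
      Complex.exp ((crankNicolson M h p ⬝ᵥ implicitEquiv M h κ : ℝ) * Complex.I)
      = Complex.exp ((p.1 ⬝ᵥ (κ + (h / 4 : ℝ) • laplacianL M κ) : ℝ) * Complex.I)
        * Complex.exp ((p.2 ⬝ᵥ fun j => κ j - κ (j + 1) : ℝ) * Complex.I) := by
    rw [← Complex.exp_add, ← add_mul, ← Complex.ofReal_add, ← crankNicolson_dotProduct]
  simp_rw [e]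
  rw [integral_prod_mul
    (fun x => Complex.exp ((x ⬝ᵥ (κ + (h / 4 : ℝ) • laplacianL M κ) : ℝ) * Complex.I))
    (fun x => Complex.exp ((x ⬝ᵥ fun j => κ j - κ (j + 1) : ℝ) * Complex.I)),
    integral_cexp_gaussianVector, integral_cexp_gaussianVector, integral_cexp_gaussianVector,
    ← Complex.exp_add, ← Complex.ofReal_neg, ← Complex.ofReal_neg, ← Complex.ofReal_neg,
    ← Complex.ofReal_add]
  -- The exponents match because `|(1 - (h/4)Δ)κ|² - |(1 + (h/4)Δ)κ|² = -h κ·Δκ`, which is exactly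
  -- the variance contributed by the noise.
  have h1 : (fun j => κ j - κ (j + 1)) ⬝ᵥ (fun j => κ j - κ (j + 1)) = -(κ ⬝ᵥ laplacianL M κ) := by
    rw [dotProduct_laplacianL_self, neg_neg]
    exact Finset.sum_congr rfl fun _ _ => (sq _).symm
  rw [h1, implicitEquiv_apply]
  simp only [dotProduct_sub, sub_dotProduct, dotProduct_add, add_dotProduct, dotProduct_smul,
    smul_dotProduct, smul_eq_mul, ← dotProduct_laplacianL_comm, NNReal.coe_one]
  congr 2
  ring

end CrankNicolson

/-! ### Second-order expansion of `det (1 + h A)` for trace-free `A`. -/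

section Determinant

variable {ι : Type*}

lemma abs_prod_one_add_mul_sub_one_le (s : Finset ι) {a : ι → ℝ} {h K : ℝ} (hh : 0 ≤ h)
    (hh1 : h ≤ 1) (hK : ∀ i, |a i| ≤ K) :
    |∏ i ∈ s, (1 + h * a i) - 1| ≤ h * ((1 + K) ^ s.card - 1) := by
  classical
  induction s using Finset.induction_on with
  | empty => simp
  | insert i s hi ih =>
    have hK0 : 0 ≤ K := (abs_nonneg _).trans (hK i)
    rw [Finset.prod_insert hi, Finset.card_insert_of_notMem hi, pow_succ]
    set p := ∏ i ∈ s, (1 + h * a i)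
    set q := (1 + K) ^ s.card
    have hq : 1 ≤ q := one_le_pow₀ (by linarith)
    have hp : |p| ≤ q := by
      have h1 : |p| ≤ |p - 1| + 1 := by
        have := abs_add_le (p - 1) 1
        rwa [sub_add_cancel, abs_one] at this
      nlinarith
    have e : (1 + h * a i) * p - 1 = (p - 1) + h * (a i * p) := by ring
    rw [e]
    refine (abs_add_le _ _).trans ?_
    rw [abs_mul, abs_mul, abs_of_nonneg hh]
    have h2 : |a i| * |p| ≤ K * q := mul_le_mul (hK i) hp (abs_nonneg _) hK0
    nlinarith

lemma abs_prod_one_add_mul_sub_le (s : Finset ι) {a : ι → ℝ} {h K : ℝ} (hh : 0 ≤ h)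
    (hh1 : h ≤ 1) (hK : ∀ i, |a i| ≤ K) :
    |∏ i ∈ s, (1 + h * a i) - 1 - h * ∑ i ∈ s, a i| ≤ h ^ 2 * (1 + K) ^ s.card := by
  classical
  induction s using Finset.induction_on with
  | empty => simp; positivity
  | insert i s hi ih =>
    have hK0 : 0 ≤ K := (abs_nonneg _).trans (hK i)
    have hp := abs_prod_one_add_mul_sub_one_le s hh hh1 hK
    rw [Finset.prod_insert hi, Finset.sum_insert hi, Finset.card_insert_of_notMem hi,
      pow_succ (1 + K)]
    set p := ∏ i ∈ s, (1 + h * a i)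
    set q := (1 + K) ^ s.card
    have e : (1 + h * a i) * p - 1 - h * (a i + ∑ i ∈ s, a i)
        = (p - 1 - h * ∑ i ∈ s, a i) + h * (a i * (p - 1)) := by ring
    rw [e]
    refine (abs_add_le _ _).trans ?_
    rw [abs_mul, abs_mul, abs_of_nonneg hh]
    have h2 : |a i| * |p - 1| ≤ K * (h * (q - 1)) := mul_le_mul (hK i) hp (abs_nonneg _) hK0
    have h3 : h * (|a i| * |p - 1|) ≤ h * (K * (h * (q - 1))) := mul_le_mul_of_nonneg_left h2 hh
    nlinarith [mul_nonneg (mul_nonneg hh hh) hK0]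

variable [Fintype ι] [DecidableEq ι]

/-- A non-identity permutation moves at least two points, `i` and `σ i`, and each contributes an
off-diagonal factor of size `O(h)`. -/
lemma abs_prod_perm_one_add_smul_le (A : Matrix ι ι ℝ) {h K : ℝ} (hh : 0 ≤ h) (hh1 : h ≤ 1)
    (hK : ∀ i j, |A i j| ≤ K) {σ : Equiv.Perm ι} (hσ : σ ≠ 1) :
    |∏ i, (1 + h • A) (σ i) i| ≤ h ^ 2 * (1 + K) ^ Fintype.card ι := by
  obtain ⟨i, hi⟩ : ∃ i, σ i ≠ i := by
    by_contra! hc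
    exact hσ (Equiv.ext hc)
  have hi' : σ (σ i) ≠ σ i := fun hc => hi (σ.injective hc)
  have hK0 : 0 ≤ K := (abs_nonneg _).trans (hK i i)
  have hb (k : ι) : |(1 + h • A) (σ k) k|
      ≤ (1 + K) * (if k = i then h else 1) * (if k = σ i then h else 1) := by
    have hA : |h * A (σ k) k| ≤ h * K := by
      rw [abs_mul, abs_of_nonneg hh]
      exact mul_le_mul_of_nonneg_left (hK _ _) hh
    rw [Matrix.add_apply, Matrix.smul_apply, smul_eq_mul]
    have hoff (hk : σ k ≠ k) : |(1 : Matrix ι ι ℝ) (σ k) k + h * A (σ k) k| ≤ (1 + K) * h := by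
      rw [Matrix.one_apply_ne hk, zero_add]
      linarith
    by_cases h1 : k = i
    · subst h1
      simpa [Ne.symm hi] using hoff hi
    · by_cases h2 : k = σ i
      · subst h2
        simpa [hi] using hoff hi'
      · simp only [h1, h2, if_false, mul_one]
        refine (abs_add_le _ _).trans (add_le_add ?_ (hA.trans ?_))
        · rw [Matrix.one_apply]
          split_ifs <;> simp
        · nlinarith
  rw [Finset.abs_prod]
  refine (Finset.prod_le_prod (fun _ _ => abs_nonneg _) fun k _ => hb k).trans_eq ?_
  simp only [Finset.prod_mul_distrib, Finset.prod_const, Finset.prod_ite_eq', Finset.mem_univ,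
    if_true, Finset.card_univ]
  ring

/-- In the Leibniz expansion only the identity permutation has a first-order term, `h` times the
trace. -/
lemma abs_det_one_add_smul_sub_one_le (A : Matrix ι ι ℝ) {h K : ℝ} (hh : 0 ≤ h) (hh1 : h ≤ 1)
    (hK : ∀ i j, |A i j| ≤ K) (hA : A.trace = 0) :
    |(1 + h • A).det - 1|
      ≤ (Fintype.card (Equiv.Perm ι) * (1 + K) ^ Fintype.card ι) * h ^ 2 := by
  have e : (1 + h • A).det - 1
      = ∑ σ : Equiv.Perm ι, (Equiv.Perm.sign σ • ∏ i, (1 + h • A) (σ i) i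
        - if σ = 1 then 1 else 0) := by
    rw [Finset.sum_sub_distrib, Matrix.det_apply]
    simp
  rw [e]
  refine (Finset.abs_sum_le_sum_abs _ _).trans ?_
  rw [mul_assoc, ← nsmul_eq_mul, ← Finset.card_univ]
  refine Finset.sum_le_card_nsmul _ _ _ fun σ _ => ?_
  rw [mul_comm _ (h ^ 2)]
  by_cases hσ : σ = 1
  · subst hσ
    have h1 := abs_prod_one_add_mul_sub_le Finset.univ (a := fun i => A i i) hh hh1
      fun i => hK i i
    have h2 : ∑ i, A i i = 0 := hA
    rw [h2, mul_zero, sub_zero, Finset.card_univ] at h1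
    simpa using h1
  · have h1 := abs_prod_perm_one_add_smul_le A hh hh1 hK hσ
    rcases Int.units_eq_one_or (Equiv.Perm.sign σ) with hs | hs <;> simpa [hs, hσ] using h1

end Determinant

/-! ### The Gaussian density and tangential displacements. -/

section Density

variable {ι : Type*} [Fintype ι]

/-- The density of the standard Gaussian measure on `ι → ℝ`. -/
noncomputable def gaussianDensity (x : ι → ℝ) : ℝ := ∏ i, gaussianPDFReal 0 1 (x i)

lemma gaussianDensity_nonneg (x : ι → ℝ) : 0 ≤ gaussianDensity x :=
  Finset.prod_nonneg fun _ _ => gaussianPDFReal_nonneg _ _ _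

lemma measurable_gaussianDensity : Measurable (gaussianDensity : (ι → ℝ) → ℝ) := by
  unfold gaussianDensity
  have := measurable_gaussianPDFReal 0 1
  fun_prop

lemma gaussianVector_one_eq_withDensity :
    gaussianVector ι 1 = volume.withDensity fun x => ENNReal.ofReal (gaussianDensity x) := by
  unfold gaussianVector
  refine Measure.pi_eq ?_
  intro s hs
  have hi (i : ι) : Integrable (gaussianPDFReal 0 1) (volume.restrict (s i)) :=
    (integrable_gaussianPDFReal 0 1).restrict
  rw [withDensity_apply _ (MeasurableSet.univ_pi hs), volume_pi,
    Measure.restrict_pi_pi (fun _ => (volume : Measure ℝ)) s]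
  unfold gaussianDensity
  rw [← ofReal_integral_eq_lintegral_ofReal (Integrable.fintype_prod hi)
    (ae_of_all _ fun _ => Finset.prod_nonneg fun _ _ => gaussianPDFReal_nonneg _ _ _),
    integral_fintype_prod_eq_prod, ENNReal.ofReal_prod_of_nonneg
      fun _ _ => integral_nonneg fun _ => gaussianPDFReal_nonneg _ _ _]
  simp_rw [gaussianReal_apply_eq_integral 0 one_ne_zero]

lemma integral_gaussianVector_one (f : (ι → ℝ) → ℝ) :
    ∫ x, f x ∂gaussianVector ι 1 = ∫ x, gaussianDensity x * f x := by
  rw [gaussianVector_one_eq_withDensity, integral_withDensity_eq_integral_toReal_smul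
    measurable_gaussianDensity.ennreal_ofReal (ae_of_all _ fun _ => ENNReal.ofReal_lt_top)]
  simp [ENNReal.toReal_ofReal (gaussianDensity_nonneg _)]

/-- By Pythagoras, a displacement orthogonal to `x` changes `|x|²` only at second order. -/
lemma gaussianDensity_add_smul {x v : ι → ℝ} (hxv : x ⬝ᵥ v = 0) (h : ℝ) :
    gaussianDensity (x + h • v) = Real.exp (-(h ^ 2 * (v ⬝ᵥ v) / 2)) * gaussianDensity x := by
  have e (y : ι → ℝ) : gaussianDensity y
      = (∏ _ : ι, (√(2 * Real.pi * (1 : ℝ≥0)))⁻¹) * Real.exp (-(y ⬝ᵥ y) / 2) := by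
    simp only [gaussianDensity, gaussianPDFReal, Finset.prod_mul_distrib, ← Real.exp_sum]
    congr 2
    simp only [dotProduct, ← Finset.sum_neg_distrib, Finset.sum_div]
    exact Finset.sum_congr rfl fun _ _ => by simp; ring
  have e2 : (x + h • v) ⬝ᵥ (x + h • v) = x ⬝ᵥ x + h ^ 2 * (v ⬝ᵥ v) := by
    simp only [dotProduct_add, add_dotProduct, dotProduct_smul, smul_dotProduct, smul_eq_mul, hxv,
      dotProduct_comm v x]
    ring
  rw [e, e, e2, mul_left_comm, ← Real.exp_add]
  congr 2
  ring

end Density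

/-! ### Almost invariance under an Euler step. -/

section Euler

variable {ι : Type*} [Fintype ι] {b : (ι → ℝ) → ι → ℝ}

/-- A preimage of `y` is a fixed point of the contraction `x ↦ y - h b x`. -/
lemma bijective_add_smul {K : ℝ≥0} (hb : LipschitzWith K b) {h : ℝ≥0} (hh : h * K < 1) :
    Function.Bijective fun x : ι → ℝ => x + (h : ℝ) • b x := by
  have hc (y : ι → ℝ) : ContractingWith (h * K) fun x : ι → ℝ => y - (h : ℝ) • b x := by
    refine ⟨hh, LipschitzWith.of_dist_le_mul fun x x' => ?_⟩
    rw [dist_sub_left, dist_smul₀, NNReal.coe_mul, mul_assoc, Real.norm_eq_abs, NNReal.abs_eq]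
    exact mul_le_mul_of_nonneg_left (hb.dist_le_mul x x') h.2
  constructor
  · intro x x' hx
    refine (hc (x' + (h : ℝ) • b x')).fixedPoint_unique' ?_ ?_
    · change _ - _ = _
      rw [← show x + (h : ℝ) • b x = x' + (h : ℝ) • b x' from hx, add_sub_cancel_right]
    · change _ - _ = _
      rw [add_sub_cancel_right]
  · intro y
    have hy : y - (h : ℝ) • b ((hc y).fixedPoint _) = (hc y).fixedPoint _ :=
      (hc y).fixedPoint_isFixedPt
    exact ⟨(hc y).fixedPoint _, (sub_eq_iff_eq_add.1 hy).symm⟩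

variable [DecidableEq ι]

lemma IsConservative.exists_lipschitzWith (hb : IsConservative b) : ∃ K, LipschitzWith K b :=
  hb.contDiff.lipschitzWith_of_hasCompactSupport hb.hasCompactSupport one_ne_zero

/-- The Jacobian determinant of an Euler step along a conservative field is `1 + O(h²)`. -/
lemma IsConservative.abs_det_sub_one_le (hb : IsConservative b) {K : ℝ≥0}
    (hK : LipschitzWith K b) {h : ℝ} (hh : 0 ≤ h) (hh1 : h ≤ 1) (x : ι → ℝ) :
    |(ContinuousLinearMap.id ℝ (ι → ℝ) + h • fderiv ℝ b x).det - 1|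
      ≤ (Fintype.card (Equiv.Perm ι) * (1 + K) ^ Fintype.card ι) * h ^ 2 := by
  set A := LinearMap.toMatrix' (fderiv ℝ b x).toLinearMap with hA
  have hdet : (ContinuousLinearMap.id ℝ (ι → ℝ) + h • fderiv ℝ b x).det = (1 + h • A).det := by
    rw [ContinuousLinearMap.det, ← LinearMap.det_toMatrix']
    congr 1
    simp [hA, LinearMap.toMatrix'_id]
  have hentry (i j : ι) : A i j = fderiv ℝ b x (Pi.single j 1) i := by
    simp [hA, LinearMap.toMatrix'_apply]
  rw [hdet]
  refine abs_det_one_add_smul_sub_one_le A hh hh1 (fun i j => ?_) ?_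
  · rw [hentry, ← Real.norm_eq_abs]
    refine (norm_le_pi_norm _ i).trans (((fderiv ℝ b x).le_opNorm _).trans ?_)
    rw [Pi.norm_single, norm_one, mul_one]
    exact norm_fderiv_le_of_lipschitz ℝ hK
  · have := hb.divergence x
    rw [SasamotoSpohn.divergence] at this
    simpa [Matrix.trace, hentry] using this

lemma IsConservative.exists_dotProduct_self_le (hb : IsConservative b) :
    ∃ B : ℝ, 0 ≤ B ∧ ∀ x, b x ⬝ᵥ b x ≤ B := by
  obtain ⟨B, hB⟩ := hb.hasCompactSupport.exists_bound_of_continuous hb.contDiff.continuous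
  refine ⟨∑ _ : ι, B ^ 2, by positivity, fun x => Finset.sum_le_sum fun i _ => ?_⟩
  rw [← sq]
  exact sq_le_sq' (abs_le.1 ((norm_le_pi_norm (b x) i).trans (hB x))).1
    (abs_le.1 ((norm_le_pi_norm (b x) i).trans (hB x))).2

/-- Here `d` stands for the Jacobian determinant of the Euler step and `q` for `b x ⬝ᵥ b x`; the
product is the weight in the change of variables. -/
lemma abs_abs_mul_exp_neg_sub_one_le {d B c h q : ℝ} (hB : 0 ≤ B) (hh : 0 ≤ h) (hh1 : h ≤ 1)
    (hd : |d - 1| ≤ c * h ^ 2) (hq0 : 0 ≤ q) (hq : q ≤ B) :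
    |1 - |d| * Real.exp (-(h ^ 2 * q / 2))| ≤ (c + (1 + c) * B) * h ^ 2 := by
  have hc : 0 ≤ c * h ^ 2 := (abs_nonneg _).trans hd
  have h1 : |(1 - |d|)| ≤ c * h ^ 2 := by
    have := abs_abs_sub_abs_le 1 d
    rw [abs_one, abs_sub_comm 1 d] at this
    exact this.trans hd
  have h2 : |d| ≤ 1 + c * h ^ 2 := by linarith [(abs_le.1 h1).1]
  have h3 : 1 - h ^ 2 * q / 2 ≤ Real.exp (-(h ^ 2 * q / 2)) := by
    linarith [Real.add_one_le_exp (-(h ^ 2 * q / 2))]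
  have h4 : Real.exp (-(h ^ 2 * q / 2)) ≤ 1 := Real.exp_le_one_iff.2 (by
    have : 0 ≤ h ^ 2 * q / 2 := by positivity
    linarith)
  set ex := Real.exp (-(h ^ 2 * q / 2))
  have h5 : |1 - ex| ≤ h ^ 2 * B := by
    rw [abs_of_nonneg (by linarith)]
    nlinarith [mul_le_mul_of_nonneg_left hq (sq_nonneg h), mul_nonneg (sq_nonneg h) hq0]
  have e : 1 - |d| * ex = (1 - |d|) + |d| * (1 - ex) := by ring
  rw [e]
  refine (abs_add_le _ _).trans ?_
  rw [abs_mul, abs_abs]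
  have h6 : |d| * |1 - ex| ≤ (1 + c * h ^ 2) * (h ^ 2 * B) :=
    mul_le_mul h2 h5 (abs_nonneg _) (by linarith)
  have h7 : h ^ 2 ≤ 1 := pow_le_one₀ hh hh1
  nlinarith [mul_nonneg (mul_nonneg hc (sub_nonneg.2 h7)) hB]

/-- An Euler step along a conservative vector field almost preserves the standard Gaussian
measure, with an error of second order in total variation. -/
theorem IsConservative.exists_abs_integral_euler_sub_le (hb : IsConservative b) :
    ∃ C h₀ : ℝ, 0 < h₀ ∧ ∀ h : ℝ≥0, h ≤ h₀ → ∀ f : (ι → ℝ) → ℝ, Measurable f →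
      (∀ x, |f x| ≤ 1) →
      |∫ x, f (x + (h : ℝ) • b x) ∂gaussianVector ι 1 - ∫ x, f x ∂gaussianVector ι 1|
        ≤ C * h ^ 2 := by
  obtain ⟨K, hK⟩ := hb.exists_lipschitzWith
  obtain ⟨B, hB0, hB⟩ := hb.exists_dotProduct_self_le
  set c : ℝ := Fintype.card (Equiv.Perm ι) * (1 + K) ^ Fintype.card ι with hc
  -- The threshold `(1 + K)⁻¹` secures both `h ≤ 1` and `h * K < 1`.
  refine ⟨c + (1 + c) * B, (1 + K)⁻¹, by positivity, fun h hh f hf hf1 => ?_⟩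
  have hh1 : (h : ℝ) ≤ 1 := hh.trans (inv_le_one_of_one_le₀ (by linarith [K.2]))
  have hhK : h * K < 1 := by
    rw [← NNReal.coe_lt_coe]
    push_cast
    have h1 : (h : ℝ) * (1 + K) ≤ 1 := by
      rwa [← le_div_iff₀ (by positivity), one_div]
    rcases eq_or_ne h 0 with rfl | h0
    · simp
    · have : (0 : ℝ) < h := NNReal.coe_pos.2 (pos_iff_ne_zero.2 h0)
      linarith
  have hbij := bijective_add_smul hK hhK
  set J : (ι → ℝ) → ℝ := fun x =>
    |(ContinuousLinearMap.id ℝ (ι → ℝ) + (h : ℝ) • fderiv ℝ b x).det|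
      * Real.exp (-((h : ℝ) ^ 2 * (b x ⬝ᵥ b x) / 2)) with hJ
  have hJ1 (x : ι → ℝ) : |1 - J x| ≤ (c + (1 + c) * B) * h ^ 2 :=
    abs_abs_mul_exp_neg_sub_one_le hB0 h.2 hh1 (hb.abs_det_sub_one_le hK h.2 hh1 x)
      (dotProduct_self_nonneg' _) (hB x)
  -- Changing variables in the unperturbed integral makes both integrands contain `f (x + h b x)`,
  -- so no regularity of `f` is needed.
  have hchange : ∫ x, f x ∂gaussianVector ι 1
      = ∫ x, J x * f (x + (h : ℝ) • b x) ∂gaussianVector ι 1 := by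
    rw [integral_gaussianVector_one, integral_gaussianVector_one]
    have hd (x : ι → ℝ) (_ : x ∈ univ) : HasFDerivWithinAt (fun x : ι → ℝ => x + (h : ℝ) • b x)
        (ContinuousLinearMap.id ℝ (ι → ℝ) + (h : ℝ) • fderiv ℝ b x) univ x :=
      ((hasFDerivAt_id x).add
        ((hb.contDiff.differentiable one_ne_zero x).hasFDerivAt.const_smul (h : ℝ))).hasFDerivWithinAt
    have := integral_image_eq_integral_abs_det_fderiv_smul volume MeasurableSet.univ hd
      hbij.injective.injOn fun x => gaussianDensity x * f x
    rw [image_univ, hbij.surjective.range_eq] at this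
    simp only [Measure.restrict_univ] at this
    rw [this]
    refine integral_congr_ae (ae_of_all _ fun x => ?_)
    simp only [hJ, smul_eq_mul, gaussianDensity_add_smul (hb.dotProduct_self x)]
    ring
  have hmeas : Measurable fun x : ι → ℝ => x + (h : ℝ) • b x :=
    (continuous_id.add (hb.contDiff.continuous.const_smul (h : ℝ))).measurable
  have hJm : Measurable J := by
    have hdet : Continuous fun x =>
        (ContinuousLinearMap.id ℝ (ι → ℝ) + (h : ℝ) • fderiv ℝ b x).det := by
      have := hb.contDiff.continuous_fderiv one_ne_zero
      exact ContinuousLinearMap.continuous_det.comp (by fun_prop)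
    have hexp : Continuous fun x => Real.exp (-((h : ℝ) ^ 2 * (b x ⬝ᵥ b x) / 2)) := by
      have := hb.contDiff.continuous
      unfold dotProduct
      fun_prop
    exact (hdet.abs.mul hexp).measurable
  have hi1 : Integrable (fun x => f (x + (h : ℝ) • b x)) (gaussianVector ι 1) :=
    Integrable.of_bound (hf.comp hmeas).aestronglyMeasurable 1 (ae_of_all _ fun x => hf1 _)
  have hi2 : Integrable (fun x => J x * f (x + (h : ℝ) • b x)) (gaussianVector ι 1) := by
    refine hi1.bdd_mul (c := 1 + (c + (1 + c) * B) * h ^ 2) hJm.aestronglyMeasurable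
      (ae_of_all _ fun x => ?_)
    have h1 := abs_sub_abs_le_abs_sub (J x) 1
    rw [abs_one, abs_sub_comm] at h1
    rw [Real.norm_eq_abs]
    linarith [hJ1 x]
  rw [hchange, ← integral_sub hi1 hi2]
  have := norm_integral_le_of_norm_le_const (μ := gaussianVector ι 1)
    (f := fun x => f (x + (h : ℝ) • b x) - J x * f (x + (h : ℝ) • b x))
    (C := (c + (1 + c) * B) * h ^ 2) (ae_of_all _ fun x => ?_)
  · simpa using this
  · have e : f (x + (h : ℝ) • b x) - J x * f (x + (h : ℝ) • b x)
        = (1 - J x) * f (x + (h : ℝ) • b x) := by ring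
    rw [e, norm_mul, Real.norm_eq_abs, Real.norm_eq_abs]
    calc |1 - J x| * |f (x + (h : ℝ) • b x)| ≤ |1 - J x| * 1 :=
          mul_le_mul_of_nonneg_left (hf1 _) (abs_nonneg _)
      _ ≤ _ := by rw [mul_one]; exact hJ1 x

end Euler

/-! ### Independence of the Brownian increments over sites and times. -/

section Independence

variable {Ω : Type*} [MeasurableSpace Ω] {P : Measure Ω}

lemma indepFun_prodMk_left {α β δ : Type*} [MeasurableSpace α] [MeasurableSpace β]
    [MeasurableSpace δ] [IsProbabilityMeasure P] {A : Ω → α} {B : Ω → β} {C : Ω → δ}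
    (hA : AEMeasurable A P) (hB : AEMeasurable B P) (hC : AEMeasurable C P)
    (h1 : IndepFun A (fun ω => (B ω, C ω)) P) (h2 : IndepFun B C P) :
    IndepFun (fun ω => (A ω, B ω)) C P := by
  have hAB : IndepFun A B P := h1.comp measurable_id measurable_fst
  rw [indepFun_iff_map_prod_eq_prod_map_map (by fun_prop) (by fun_prop)] at h1 h2 hAB ⊢
  rw [h2] at h1
  have := Measure.isProbabilityMeasure_map (μ := P) hC
  have := Measure.isProbabilityMeasure_map (μ := P) hB
  rw [hAB, ← MeasurableEquiv.prodAssoc.map_measurableEquiv_injective.eq_iff,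
    Measure.prodAssoc_prod, ← h1,
    AEMeasurable.map_map_of_aemeasurable (by fun_prop) (by fun_prop)]
  rfl

/-- The Brownian increments over the grid of mesh `h`. -/
noncomputable def noiseIncrement {M : ℕ} (ξ : ZMod M → ℝ≥0 → Ω → ℝ) (h : ℝ≥0) (k : ℕ) (ω : Ω)
    (j : ZMod M) : ℝ :=
  ξ j ((k + 1 : ℕ) * h) ω - ξ j (k * h) ω

variable {M : ℕ} {ξ : ZMod M → ℝ≥0 → Ω → ℝ}

/-- Independence between sites and independence of increments in time at each site combine to joint
independence over all pairs. -/
lemma iIndepFun_noiseIncrement (hξ : IsNoise ξ P) (h : ℝ≥0) :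
    iIndepFun (fun (p : ZMod M × ℕ) ω => noiseIncrement ξ h p.2 ω p.1) P := by
  have hm (j : ZMod M) (k : ℕ) : AEMeasurable (fun ω => noiseIncrement ξ h k ω j) P :=
    ((hξ.isBrownian j).aemeasurable _).sub ((hξ.isBrownian j).aemeasurable _)
  have h1 : iIndepFun (fun (j : ZMod M) ω (k : ℕ) => noiseIncrement ξ h k ω j) P :=
    hξ.indep.comp (fun _ p k => p ((k + 1 : ℕ) * h) - p (k * h)) fun _ => by fun_prop
  have h2 (j : ZMod M) : iIndepFun (fun (k : ℕ) ω => noiseIncrement ξ h k ω j) P :=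
    (hξ.isBrownian j).hasIndepIncrements.nat (t := fun k : ℕ => (k : ℝ≥0) * h)
      fun a b hab => mul_le_mul_left (by exact_mod_cast hab) h
  have h3 := iIndepFun_uncurry' (X := fun j k => (hm j k).mk _) (P := P)
    (fun j k => (hm j k).measurable_mk)
    (iIndepFun.process_congr (X := fun j k ω => noiseIncrement ξ h k ω j) h1
      fun j k => (hm j k).ae_eq_mk)
    fun j => (h2 j).congr fun k => (hm j k).ae_eq_mk
  exact h3.congr fun p => (hm p.1 p.2).ae_eq_mk.symm

variable [NeZero M]

lemma aemeasurable_noiseIncrement (hξ : IsNoise ξ P) (h : ℝ≥0) (k : ℕ) :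
    AEMeasurable (noiseIncrement ξ h k) P :=
  aemeasurable_pi_lambda _ fun j =>
    ((hξ.isBrownian j).aemeasurable _).sub ((hξ.isBrownian j).aemeasurable _)

lemma hasLaw_noiseIncrement (hξ : IsNoise ξ P) (h : ℝ≥0) (k : ℕ) :
    HasLaw (noiseIncrement ξ h k) (gaussianVector (ZMod M) h) P := by
  refine iIndepFun.hasLaw_pi (fun j => ?_) (hξ.indep.comp
    (fun _ p => p ((k + 1 : ℕ) * h) - p (k * h)) fun _ => by fun_prop)
  have h1 := (hξ.isBrownian j).hasLaw_sub ((k + 1 : ℕ) * h) (k * h)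
  have h2 : nndist (((k + 1 : ℕ) * h : ℝ≥0) : ℝ) ((k * h : ℝ≥0) : ℝ) = h := by
    ext
    rw [coe_nndist, Real.dist_eq]
    push_cast
    rw [show ((k : ℝ) + 1) * h - k * h = h by ring, NNReal.abs_eq]
  convert h1
  · rfl
  · exact h2.symm

lemma indepFun_noiseIncrement_future (hξ : IsNoise ξ P) (h : ℝ≥0) (n : ℕ) :
    IndepFun (noiseIncrement ξ h n) (fun ω k => noiseIncrement ξ h (n + 1 + k) ω) P := by
  have := hξ.indep.isProbabilityMeasure
  refine IndepFun.indepFun_process₀ (aemeasurable_noiseIncrement hξ h n)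
    (fun k => aemeasurable_noiseIncrement hξ h _) fun I => ?_
  have hd : Disjoint (Finset.univ ×ˢ {n} : Finset (ZMod M × ℕ))
      (Finset.univ ×ˢ I.image fun k => n + 1 + k) := by
    rw [Finset.disjoint_left]
    rintro ⟨j, k⟩ h1 h2
    simp only [Finset.mem_product, Finset.mem_univ, Finset.mem_singleton, true_and,
      Finset.mem_image] at h1 h2
    obtain ⟨i, -, hi⟩ := h2
    omega
  have hi := (iIndepFun_noiseIncrement hξ h).indepFun_finset₀ _ _ hd
    fun p => (aemeasurable_pi_iff.1 (aemeasurable_noiseIncrement hξ h p.2)) p.1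
  exact hi.comp (φ := fun (x : (Finset.univ ×ˢ {n} : Finset (ZMod M × ℕ)) → ℝ) (j : ZMod M) =>
      x ⟨(j, n), by simp⟩)
    (ψ := fun (x : (Finset.univ ×ˢ I.image fun k => n + 1 + k : Finset (ZMod M × ℕ)) → ℝ)
      (k : I) (j : ZMod M) => x ⟨(j, n + 1 + k), by simp⟩)
    (by fun_prop) (by fun_prop)

end Independence

/-! ### The splitting scheme and its law. -/

section Scheme

variable {M : ℕ} [NeZero M] {b : (ZMod M → ℝ) → ZMod M → ℝ}

/-- The splitting scheme: an Euler step along `b` followed by a Crank-Nicolson step for the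
linear stochastic part with Brownian increments `η`. -/
noncomputable def scheme (b : (ZMod M → ℝ) → ZMod M → ℝ) (h : ℝ≥0) (x₀ : ZMod M → ℝ)
    (η : ℕ → ZMod M → ℝ) : ℕ → ZMod M → ℝ
  | 0 => x₀
  | n + 1 =>
    crankNicolson M h (scheme b h x₀ η n + (h : ℝ) • b (scheme b h x₀ η n), η n)

variable {Ω : Type*} [MeasurableSpace Ω] {P : Measure Ω} {X₀ : Ω → ZMod M → ℝ} {ξ : ZMod M → ℝ≥0 → Ω → ℝ}

lemma aemeasurable_scheme (hb : Continuous b) (hξ : IsNoise ξ P) (hX₀ : AEMeasurable X₀ P)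
    (h : ℝ≥0) (n : ℕ) :
    AEMeasurable (fun ω => scheme b h (X₀ ω) (fun k => noiseIncrement ξ h k ω) n) P := by
  induction n with
  | zero => exact hX₀
  | succ n ih =>
    have hη := aemeasurable_noiseIncrement hξ h n
    have hs : Measurable fun x : ZMod M → ℝ => x + (h : ℝ) • b x :=
      (continuous_id.add (hb.const_smul (h : ℝ))).measurable
    exact (crankNicolson M h).continuous.measurable.comp_aemeasurable
      ((hs.comp_aemeasurable ih).prodMk hη)

variable [IsProbabilityMeasure P]

/-- The induction carries independence from the whole future of increments, so that each step can
peel off the first one and keep the rest. -/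
lemma indepFun_scheme_noiseIncrement (hb : Continuous b) (hξ : IsNoise ξ P)
    (hX₀ : AEMeasurable X₀ P)
    (hindep : IndepFun X₀ (fun ω (j : ZMod M) (t : ℝ≥0) => ξ j t ω) P) (h : ℝ≥0) (n : ℕ) :
    IndepFun (fun ω => scheme b h (X₀ ω) (fun k => noiseIncrement ξ h k ω) n)
      (fun ω k => noiseIncrement ξ h (n + k) ω) P := by
  induction n with
  | zero =>
    exact hindep.comp (φ := id) (ψ := fun p k j => p j ((0 + k + 1 : ℕ) * h) - p j ((0 + k : ℕ) * h))
      measurable_id (by fun_prop)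
  | succ n ih =>
    have hη (k : ℕ) := aemeasurable_noiseIncrement hξ h k
    have hs : Measurable fun x : ZMod M → ℝ => x + (h : ℝ) • b x :=
      (continuous_id.add (hb.const_smul (h : ℝ))).measurable
    have h1 := indepFun_prodMk_left (aemeasurable_scheme hb hξ hX₀ h n) (hη n)
      (aemeasurable_pi_lambda (fun ω k => noiseIncrement ξ h (n + 1 + k) ω) fun k => hη _)
      (ih.comp (φ := id) (ψ := fun x => (x 0, fun k => x (1 + k))) measurable_id (by fun_prop)
        |>.congr (Eventually.of_forall fun _ => rfl)
          (Eventually.of_forall fun ω => by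
            simp only [Function.comp_apply, add_zero, Prod.mk.injEq, true_and]
            ext k j
            rw [add_assoc]))
      (indepFun_noiseIncrement_future hξ h n)
    have hφ : Measurable fun p : (ZMod M → ℝ) × (ZMod M → ℝ) =>
        crankNicolson M h (p.1 + (h : ℝ) • b p.1, p.2) :=
      (crankNicolson M h).continuous.measurable.comp
        ((hs.comp measurable_fst).prodMk measurable_snd)
    exact h1.comp hφ measurable_id

/-- The law of the splitting scheme stays close to the standard Gaussian measure. -/
lemma abs_integral_scheme_sub_le (hb : Continuous b) {C : ℝ} {h : ℝ≥0}
    (hC : ∀ f : (ZMod M → ℝ) → ℝ, Measurable f → (∀ x, |f x| ≤ 1) →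
      |∫ x, f (x + (h : ℝ) • b x) ∂gaussianVector (ZMod M) 1
        - ∫ x, f x ∂gaussianVector (ZMod M) 1| ≤ C * h ^ 2)
    (hξ : IsNoise ξ P) (hX₀ : HasLaw X₀ (gaussianVector (ZMod M) 1) P)
    (hindep : IndepFun X₀ (fun ω (j : ZMod M) (t : ℝ≥0) => ξ j t ω) P) (n : ℕ)
    {f : (ZMod M → ℝ) → ℝ} (hf : Measurable f) (hf1 : ∀ x, |f x| ≤ 1) :
    |∫ ω, f (scheme b h (X₀ ω) (fun k => noiseIncrement ξ h k ω) n) ∂P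
      - ∫ x, f x ∂gaussianVector (ZMod M) 1| ≤ n * (C * h ^ 2) := by
  induction n generalizing f with
  | zero => simp [scheme, hX₀.integral_comp (f := f) hf.aestronglyMeasurable, ← Function.comp_def]
  | succ n ih =>
    -- `G` averages `f` over the Crank–Nicolson noise. It is again measurable and bounded by one, so
    -- `ih` and `hC` apply to it, and by exact invariance its Gaussian mean is that of `f`.
    set G : (ZMod M → ℝ) → ℝ := fun y =>
      ∫ η, f (crankNicolson M h (y, η)) ∂gaussianVector (ZMod M) h with hG
    have hfc : Measurable fun p => f (crankNicolson M h p) :=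
      hf.comp (crankNicolson M h).continuous.measurable
    have hGm : Measurable G := hfc.stronglyMeasurable.integral_prod_right.measurable
    have hG1 (y : ZMod M → ℝ) : |G y| ≤ 1 := by
      have := norm_integral_le_of_norm_le_const (μ := gaussianVector (ZMod M) h)
        (f := fun η => f (crankNicolson M h (y, η))) (C := 1) (ae_of_all _ fun η => hf1 _)
      simpa using this
    have hs : Measurable fun x : ZMod M → ℝ => x + (h : ℝ) • b x :=
      (continuous_id.add (hb.const_smul (h : ℝ))).measurable
    set Y := fun ω => scheme b h (X₀ ω) (fun k => noiseIncrement ξ h k ω) n with hY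
    have hYm : AEMeasurable Y P := aemeasurable_scheme hb hξ hX₀.aemeasurable h n
    have hη := aemeasurable_noiseIncrement hξ h n
    have hind : IndepFun Y (noiseIncrement ξ h n) P :=
      (indepFun_scheme_noiseIncrement hb hξ hX₀.aemeasurable hindep h n).comp
        (ψ := fun x : ℕ → ZMod M → ℝ => x 0) measurable_id (by fun_prop)
    have := Measure.isProbabilityMeasure_map hYm
    have e1 : ∫ ω, f (scheme b h (X₀ ω) (fun k => noiseIncrement ξ h k ω) (n + 1)) ∂P
        = ∫ ω, G (Y ω + (h : ℝ) • b (Y ω)) ∂P := by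
      have hφ : Measurable fun p : (ZMod M → ℝ) × (ZMod M → ℝ) =>
          f (crankNicolson M h (p.1 + (h : ℝ) • b p.1, p.2)) :=
        hfc.comp ((hs.comp measurable_fst).prodMk measurable_snd)
      calc _ = ∫ p, f (crankNicolson M h (p.1 + (h : ℝ) • b p.1, p.2))
            ∂(P.map fun ω => (Y ω, noiseIncrement ξ h n ω)) :=
            (integral_map (hYm.prodMk hη) hφ.aestronglyMeasurable).symm
        _ = ∫ x, G (x + (h : ℝ) • b x) ∂(P.map Y) := by
            rw [hind.map_prod_eq_prod_map_map hYm hη, (hasLaw_noiseIncrement hξ h n).map_eq,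
              integral_prod]
            exact Integrable.of_bound hφ.aestronglyMeasurable 1 (ae_of_all _ fun _ => hf1 _)
        _ = _ := integral_map hYm (hGm.comp hs).aestronglyMeasurable
    have e2 : ∫ y, G y ∂gaussianVector (ZMod M) 1 = ∫ x, f x ∂gaussianVector (ZMod M) 1 := by
      conv_rhs => rw [← map_crankNicolson h]
      rw [integral_map (by fun_prop) hf.aestronglyMeasurable, integral_prod]
      exact Integrable.of_bound hfc.aestronglyMeasurable 1 (ae_of_all _ fun _ => hf1 _)
    have h1 := ih (hGm.comp hs) fun x => hG1 _
    have h2 := hC G hGm hG1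
    rw [e1, ← e2]
    simp only [Function.comp_apply] at h1
    push_cast
    calc _ ≤ _ := abs_sub_le _ (∫ x, G (x + (h : ℝ) • b x) ∂gaussianVector (ZMod M) 1) _
      _ ≤ n * (C * h ^ 2) + C * h ^ 2 := add_le_add h1 h2
      _ = _ := by ring

end Scheme

/-! ### Pathwise convergence of the scheme. -/

section Convergence

variable {M : ℕ}

/-- The increments of a path over the grid of mesh `h`. -/
noncomputable def increment (X : ℝ≥0 → ZMod M → ℝ) (h : ℝ≥0) (k : ℕ) : ZMod M → ℝ :=
  X ((k + 1 : ℕ) * h) - X (k * h)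

variable [NeZero M]

/-- `u` solves `du = (½ Δ u + b(u)) dt + D dX` on `[0, T]` with `u(0) = x₀`. -/
def SolvesOn (b : (ZMod M → ℝ) → ZMod M → ℝ) (X : ℝ≥0 → ZMod M → ℝ) (x₀ : ZMod M → ℝ) (T : ℝ≥0)
    (u : ℝ≥0 → ZMod M → ℝ) : Prop :=
  ∀ t ≤ T, u t = x₀ + (∫ s in (0 : ℝ)..t,
    ((1 / 2 : ℝ) • laplacianL M (u s.toNNReal) + b (u s.toNNReal))) + backwardDiff M (X t)

lemma SolvesOn.mono {b : (ZMod M → ℝ) → ZMod M → ℝ} {X : ℝ≥0 → ZMod M → ℝ} {x₀ : ZMod M → ℝ}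
    {T T' : ℝ≥0} {u : ℝ≥0 → ZMod M → ℝ} (hu : SolvesOn b X x₀ T u) (h : T' ≤ T) :
    SolvesOn b X x₀ T' u :=
  fun t ht => hu t (ht.trans h)

variable {b : (ZMod M → ℝ) → ZMod M → ℝ} {X : ℝ≥0 → ZMod M → ℝ}
  {x₀ : ZMod M → ℝ} {T : ℝ≥0} {u : ℝ≥0 → ZMod M → ℝ} {K : ℝ≥0}

/-- The local consistency error of the splitting scheme. -/
lemma norm_integral_sub_le (hK : LipschitzWith K b) (hu : Continuous u) {a h : ℝ≥0} {ε : ℝ}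
    (hε : ∀ s ∈ Icc a (a + h), ∀ r ∈ Icc a (a + h), ‖u s - u r‖ ≤ ε) :
    ‖(∫ s in (a : ℝ)..(a + h : ℝ≥0),
        ((1 / 2 : ℝ) • laplacianL M (u s.toNNReal) + b (u s.toNNReal)))
      - ((h : ℝ) • b (u a) + (h / 4 : ℝ) • laplacianL M (u (a + h) + u a))‖
      ≤ h * ((K + 2) * ε) := by
  have hbc := hK.continuous
  have hc : (h : ℝ) • b (u a) + (h / 4 : ℝ) • laplacianL M (u (a + h) + u a)
      = ∫ _ in (a : ℝ)..(a + h : ℝ≥0),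
        (b (u a) + (1 / 4 : ℝ) • laplacianL M (u (a + h) + u a)) := by
    rw [intervalIntegral.integral_const, NNReal.coe_add, add_sub_cancel_left, smul_add, smul_smul]
    congr 2
    ring
  rw [hc, ← intervalIntegral.integral_sub]
  rotate_left
  · exact Continuous.intervalIntegrable (by fun_prop) _ _
  · exact Continuous.intervalIntegrable (by fun_prop) _ _
  refine (intervalIntegral.norm_integral_le_of_norm_le_const (C := (K + 2) * ε)
    fun s hs => ?_).trans_eq ?_
  · rw [uIoc_of_le (by simp)] at hs
    have hs' : s.toNNReal ∈ Icc a (a + h) :=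
      ⟨NNReal.le_toNNReal_of_coe_le hs.1.le, Real.toNNReal_le_iff_le_coe.2 hs.2⟩
    set y := u s.toNNReal with hy
    -- Splitting `½Δy` into two quarters compares it with both endpoints; each quarter costs `ε` as
    -- `‖Δ‖ ≤ 4`, and `b` costs `K ε`.
    have e : (1 / 2 : ℝ) • laplacianL M y + b y
          - (b (u a) + (1 / 4 : ℝ) • laplacianL M (u (a + h) + u a))
        = (1 / 4 : ℝ) • laplacianL M (y - u (a + h)) + (1 / 4 : ℝ) • laplacianL M (y - u a)
          + (b y - b (u a)) := by
      simp only [map_sub, map_add]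
      module
    have h1 := hε _ hs' _ (show a + h ∈ Icc a (a + h) by simp)
    have h2 := hε _ hs' _ (show a ∈ Icc a (a + h) by simp)
    have h3 := norm_laplacianL_le (y - u (a + h))
    have h4 := norm_laplacianL_le (y - u a)
    have h5 := hK.norm_sub_le y (u a)
    have h6 : (K : ℝ) * ‖y - u a‖ ≤ K * ε := mul_le_mul_of_nonneg_left h2 K.2
    rw [e]
    refine (norm_add₃_le).trans ?_
    rw [norm_smul, norm_smul, Real.norm_eq_abs, abs_of_pos (by norm_num)]
    linarith
  · rw [NNReal.coe_add, add_sub_cancel_left, NNReal.abs_eq]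
    ring

lemma SolvesOn.sub_eq_integral (hu : SolvesOn b X x₀ T u) (hb : Continuous b) (huc : Continuous u)
    {a c : ℝ≥0} (ha : a ≤ T) (hc : c ≤ T) :
    u c - u a = (∫ s in (a : ℝ)..c,
      ((1 / 2 : ℝ) • laplacianL M (u s.toNNReal) + b (u s.toNNReal)))
      + backwardDiff M (X c - X a) := by
  have hi (p q : ℝ) : IntervalIntegrable (fun s : ℝ =>
      (1 / 2 : ℝ) • laplacianL M (u s.toNNReal) + b (u s.toNNReal)) volume p q :=
    Continuous.intervalIntegrable (by fun_prop) _ _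
  rw [← intervalIntegral.integral_interval_sub_left (hi 0 c) (hi 0 a), hu a ha, hu c hc, map_sub]
  abel

/-- One step of a discrete Grönwall inequality: the implicit term `h * e'` is absorbed using `1 / (1
- h) ≤ 1 + 2h` for `h ≤ 1 / 2`. -/
lemma le_of_one_sub_mul_le {e e' h δ κ : ℝ} (hh : 0 ≤ h) (hh2 : h ≤ 1 / 2) (he : 0 ≤ e)
    (hδ : 0 ≤ δ) (hκ : 0 ≤ κ) (H : e' ≤ e + h * κ * e + h * (e' + e) + h * δ) :
    e' ≤ e * Real.exp ((κ + 3) * h) + 2 * h * δ := by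
  have h1 : (1 + 2 * h) * (1 + h * (κ + 1)) ≤ Real.exp ((κ + 3) * h) := by
    rw [show (κ + 3) * h = 2 * h + h * (κ + 1) by ring, Real.exp_add]
    exact mul_le_mul (by linarith [Real.add_one_le_exp (2 * h)])
      (by linarith [Real.add_one_le_exp (h * (κ + 1))]) (by positivity) (Real.exp_nonneg _)
  have h2 : e' * (1 - h) ≤ e * (1 + h * (κ + 1)) + h * δ := by linarith
  have h0 : 0 ≤ e * (1 + h * (κ + 1)) + h * δ := by positivity
  have h3 : e' ≤ (1 + 2 * h) * (e * (1 + h * (κ + 1)) + h * δ) := by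
    rcases le_or_gt e' 0 with h' | h'
    · exact h'.trans (by positivity)
    · nlinarith [mul_nonneg hh (sub_nonneg.2 hh2)]
  have h4 := mul_le_mul_of_nonneg_left h1 he
  nlinarith [mul_nonneg hh hδ]

/-- The global error of the splitting scheme, in terms of the modulus of continuity of the
solution. -/
lemma SolvesOn.norm_scheme_sub_le (hu : SolvesOn b X x₀ T u) (huc : Continuous u)
    (hX : X 0 = 0) (hK : LipschitzWith K b) {B : ℝ} (hB : ∀ x, ‖b x‖ ≤ B) {h : ℝ≥0}
    (hh : (h : ℝ) ≤ 1 / 2) {ε : ℝ}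
    (hε : ∀ s ≤ T, ∀ r ≤ T, dist s r ≤ h → ‖u s - u r‖ ≤ ε) (n : ℕ) (hn : n * h ≤ T) :
    ‖scheme b h x₀ (increment X h) n - u (n * h)‖
      ≤ 2 * (n * h) * (h * B + (K + 2) * ε) * Real.exp ((K + 3) * (n * h)) := by
  have hε0 : 0 ≤ ε := (norm_nonneg _).trans (hε 0 zero_le _ zero_le (by simp))
  have hB0 : 0 ≤ B := (norm_nonneg _).trans (hB 0)
  set δ := h * B + (K + 2) * ε with hδ
  have hδ0 : 0 ≤ δ := by positivity
  induction n with
  | zero => simp [scheme, hu 0 zero_le, hX]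
  | succ n ih =>
    have hnh : (n : ℝ≥0) * h + h = (n + 1 : ℕ) * h := by push_cast; ring
    have hn' : n * h ≤ T := le_trans (by rw [← hnh]; exact le_self_add) hn
    have ih := ih hn'
    set x := scheme b h x₀ (increment X h) n with hx
    set x' := scheme b h x₀ (increment X h) (n + 1) with hx'
    have hstep : x' = (x + (h : ℝ) • b x) + (h / 4 : ℝ) • laplacianL M (x' + (x + (h : ℝ) • b x))
        + backwardDiff M (X ((n + 1 : ℕ) * h) - X (n * h)) := crankNicolson_eq _ _ _
    have hsol := hu.sub_eq_integral hK.continuous huc hn' hn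
    have hloc := norm_integral_sub_le (a := n * h) (h := h) (ε := ε) hK huc fun s hs r hr => by
      rw [hnh] at hs hr
      refine hε s (hs.2.trans hn) r (hr.2.trans hn) ?_
      rw [NNReal.dist_eq]
      have h1 : (n * h : ℝ) ≤ s := by exact_mod_cast hs.1
      have h2 : (n * h : ℝ) ≤ r := by exact_mod_cast hr.1
      have h3 : (s : ℝ) ≤ n * h + h := by rw [← hnh] at hs; exact_mod_cast hs.2
      have h4 : (r : ℝ) ≤ n * h + h := by rw [← hnh] at hr; exact_mod_cast hr.2
      rw [abs_le]
      constructor <;> linarith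
    rw [hnh] at hloc
    set v := u (n * h) with hv
    set v' := u ((n + 1 : ℕ) * h) with hv'
    set I := ∫ s in ((n * h : ℝ≥0) : ℝ)..((n + 1 : ℕ) * h : ℝ≥0),
      ((1 / 2 : ℝ) • laplacianL M (u s.toNNReal) + b (u s.toNNReal)) with hI
    -- The noise increments cancel. The extra `h • b x` under the Laplacian, due to the splitting,
    -- is the source of `h * B` in `δ`.
    have hrec : x' - v' = (x - v) + (h : ℝ) • (b x - b v)
        + (h / 4 : ℝ) • laplacianL M ((x' - v') + (x - v) + (h : ℝ) • b x)
        - (I - ((h : ℝ) • b v + (h / 4 : ℝ) • laplacianL M (v' + v))) := by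
      rw [sub_eq_iff_eq_add] at hsol
      nth_rewrite 1 [hstep, hsol]
      simp only [map_sub, map_add, map_smul]
      module
    have hbound : ‖x' - v'‖ ≤ ‖x - v‖ + h * K * ‖x - v‖ + h * (‖x' - v'‖ + ‖x - v‖) + h * δ := by
      have h1 : ‖(h : ℝ) • (b x - b v)‖ ≤ h * (K * ‖x - v‖) := by
        rw [norm_smul, Real.norm_eq_abs, NNReal.abs_eq]
        exact mul_le_mul_of_nonneg_left (hK.norm_sub_le x v) h.2
      have h2 : ‖(h / 4 : ℝ) • laplacianL M ((x' - v') + (x - v) + (h : ℝ) • b x)‖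
          ≤ h * (‖x' - v'‖ + ‖x - v‖ + h * B) := by
        rw [norm_smul, Real.norm_eq_abs, abs_of_nonneg (by positivity)]
        have h3 : ‖(x' - v') + (x - v) + (h : ℝ) • b x‖ ≤ ‖x' - v'‖ + ‖x - v‖ + h * B := by
          refine norm_add₃_le.trans ?_
          gcongr
          rw [norm_smul, Real.norm_eq_abs, NNReal.abs_eq]
          exact mul_le_mul_of_nonneg_left (hB x) h.2
        calc _ ≤ (h / 4 : ℝ) * (4 * (‖x' - v'‖ + ‖x - v‖ + h * B)) :=
              mul_le_mul_of_nonneg_left ((norm_laplacianL_le _).trans (by linarith)) (by positivity)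
          _ = _ := by ring
      have h4 : ‖x' - v'‖ ≤ ‖x - v‖ + h * (K * ‖x - v‖) + h * (‖x' - v'‖ + ‖x - v‖ + h * B)
          + h * ((K + 2) * ε) := by
        conv_lhs => rw [hrec]
        refine (norm_sub_le _ _).trans (add_le_add (norm_add₃_le.trans ?_) hloc)
        linarith
      rw [hδ]
      linarith
    have h5 := le_of_one_sub_mul_le h.2 hh (norm_nonneg _) hδ0 K.2 hbound
    refine h5.trans ?_
    push_cast
    rw [show ((K : ℝ) + 3) * (((n : ℝ) + 1) * h) = (K + 3) * (n * h) + (K + 3) * h by ring,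
      Real.exp_add]
    have h6 : 1 ≤ Real.exp ((K + 3) * (n * h)) * Real.exp ((K + 3) * h) := by
      rw [← Real.exp_add]
      exact Real.one_le_exp (by positivity)
    have h7 := mul_le_mul_of_nonneg_right ih (Real.exp_nonneg ((K + 3) * h))
    have h8 := mul_le_mul_of_nonneg_left h6 (show (0 : ℝ) ≤ 2 * h * δ by positivity)
    rw [mul_one] at h8
    exact (add_le_add h7 h8).trans_eq (by ring)

/-- The splitting scheme converges to the solution of the equation. -/
theorem SolvesOn.tendsto_scheme (hu : SolvesOn b X x₀ T u) (huc : Continuous u)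
    (hX : X 0 = 0) (hK : LipschitzWith K b) {B : ℝ} (hB : ∀ x, ‖b x‖ ≤ B) :
    Tendsto (fun N : ℕ => scheme b (T / N) x₀ (increment X (T / N)) N) atTop (𝓝 (u T)) := by
  rw [Metric.tendsto_nhds]
  intro τ hτ
  have hB0 : 0 ≤ B := (norm_nonneg _).trans (hB 0)
  set A : ℝ := 2 * T * Real.exp ((K + 3) * T) with hA
  have hA0 : 0 ≤ A := by positivity
  set ε : ℝ := τ / (2 * (A * (K + 2) + 1)) with hε
  have hε0 : 0 < ε := by positivity
  have hAε : A * ((K + 2) * ε) < τ / 2 := by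
    rw [hε]
    have : A * ((K + 2) * (τ / (2 * (A * (K + 2) + 1))))
        = (τ / 2) * ((A * (K + 2)) / (A * (K + 2) + 1)) := by
      field_simp
    rw [this]
    refine mul_lt_of_lt_one_right (by positivity) ?_
    rw [div_lt_one (by positivity)]
    linarith
  have huniform := (isCompact_Icc (a := (0 : ℝ≥0)) (b := T)).uniformContinuousOn_of_continuous
    huc.continuousOn
  obtain ⟨d, hd, hdu⟩ := Metric.uniformContinuousOn_iff.1 huniform ε hε0
  have hlim : Tendsto (fun N : ℕ => (T : ℝ) / N) atTop (𝓝 0) :=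
    tendsto_const_div_atTop_nhds_zero_nat _
  have hlim2 : Tendsto (fun N : ℕ => A * ((T : ℝ) / N * B)) atTop (𝓝 0) := by
    simpa using (hlim.mul_const B).const_mul A
  filter_upwards [hlim.eventually_lt_const hd,
    hlim.eventually_le_const (show (0 : ℝ) < 1 / 2 by norm_num),
    hlim2.eventually_lt_const (half_pos hτ), eventually_gt_atTop 0] with N h1 h2 h3 hN
  have hNT : (N : ℝ≥0) * (T / N) = T := by
    have : (N : ℝ≥0) ≠ 0 := by exact_mod_cast hN.ne'
    field_simp
  have hNT' : (N : ℝ) * ((T / N : ℝ≥0) : ℝ) = T := by exact_mod_cast congrArg NNReal.toReal hNT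
  have hcast : ((T / N : ℝ≥0) : ℝ) = (T : ℝ) / N := by push_cast; rfl
  have := hu.norm_scheme_sub_le huc hX hK hB (h := T / N) (ε := ε) (by rw [hcast]; exact h2)
    (fun s hs r hr hsr => by
      rw [← dist_eq_norm]
      exact (hdu s ⟨zero_le, hs⟩ r ⟨zero_le, hr⟩ (hsr.trans_lt (by rw [hcast]; exact h1))).le)
    N hNT.le
  rw [hNT, hNT', hcast] at this
  rw [dist_eq_norm]
  calc _ ≤ _ := this
    _ = A * ((T : ℝ) / N * B) + A * ((K + 2) * ε) := by rw [hA]; ring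
    _ < τ := by linarith

end Convergence

/-! ### Global pathwise existence and uniqueness. -/

section Existence

variable {M : ℕ}

lemma drift_eq (γ : ℝ) (x : ZMod M → ℝ) :
    drift γ x = (1 / 2 : ℝ) • laplacianL M x + γ • nonlinearity x := by
  ext j
  simp [drift]

variable [NeZero M]

lemma abs_nonlinearity_le (x : ZMod M → ℝ) (j : ZMod M) : |nonlinearity x j| ≤ 2 * ‖x‖ ^ 2 := by
  have hw (i : ZMod M) : |w x i| ≤ ‖x‖ ^ 2 := by
    have h1 := abs_le.1 (norm_le_pi_norm x i)
    have h2 := abs_le.1 (norm_le_pi_norm x (i + 1))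
    rw [w, abs_le]
    constructor <;> nlinarith
  have h1 := abs_le.1 (hw j)
  have h2 := abs_le.1 (hw (j - 1))
  rw [nonlinearity, abs_le]
  constructor <;> linarith

lemma abs_drift_le (γ : ℝ) (x : ZMod M → ℝ) (j : ZMod M) :
    |drift γ x j| ≤ (2 + 2 * |γ|) * (1 + ‖x‖ ^ 2) := by
  have h1 : |laplacian x j| ≤ 4 * ‖x‖ := by
    have := (norm_le_pi_norm (laplacianL M x) j).trans (norm_laplacianL_le x)
    rwa [laplacianL_apply] at this
  have h2 := abs_nonlinearity_le x j
  rw [drift]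
  refine (abs_add_le _ _).trans ?_
  rw [abs_mul, abs_mul, abs_of_pos (by norm_num : (0 : ℝ) < 1 / 2)]
  have h3 := mul_le_mul_of_nonneg_left h2 (abs_nonneg γ)
  nlinarith [sq_nonneg (‖x‖ - 1), abs_nonneg γ]

/-- The energy estimate for `v = u - z`, where `u` is driven by the noise `z`. -/
lemma dotProduct_drift_le (γ : ℝ) (v z : ZMod M → ℝ) :
    v ⬝ᵥ drift γ (v + z) ≤ M * ‖z‖ * (2 + 2 * |γ|) * (1 + 2 * ‖z‖ ^ 2 + 2 * (v ⬝ᵥ v)) := by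
  -- With `v = (v + z) - z`, the nonlinearity is orthogonal to `v + z`. Only the pairing of `z` with
  -- the drift can grow, and it is quadratic in `v` rather than cubic.
  have e : v ⬝ᵥ drift γ (v + z) = (1 / 2) * ((v + z) ⬝ᵥ laplacianL M (v + z))
      + -(z ⬝ᵥ drift γ (v + z)) := by
    have : (v + z) ⬝ᵥ drift γ (v + z) = (1 / 2) * ((v + z) ⬝ᵥ laplacianL M (v + z)) := by
      rw [drift_eq, dotProduct_add, dotProduct_smul, dotProduct_smul, dotProduct_nonlinearity_self]
      simp
    rw [add_dotProduct] at this
    linarith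
  have h1 : -(z ⬝ᵥ drift γ (v + z))
      ≤ M * (‖z‖ * ((2 + 2 * |γ|) * (1 + ‖v + z‖ ^ 2))) := by
    refine (neg_le_abs _).trans ((Finset.abs_sum_le_sum_abs _ _).trans ?_)
    have h2 : ∀ j ∈ (Finset.univ : Finset (ZMod M)), |z j * drift γ (v + z) j|
        ≤ ‖z‖ * ((2 + 2 * |γ|) * (1 + ‖v + z‖ ^ 2)) := fun j _ => by
      rw [abs_mul]
      exact mul_le_mul (norm_le_pi_norm z j) (abs_drift_le γ _ j) (abs_nonneg _) (norm_nonneg _)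
    refine (Finset.sum_le_card_nsmul _ _ _ h2).trans_eq ?_
    rw [Finset.card_univ, ZMod.card, nsmul_eq_mul]
  have h3 : ‖v + z‖ ^ 2 ≤ 2 * ‖z‖ ^ 2 + 2 * (v ⬝ᵥ v) := by
    have h4 := sq_norm_le_dotProduct_self v
    have h5 := norm_add_le v z
    nlinarith [sq_nonneg (‖v‖ - ‖z‖), norm_nonneg (v + z), norm_nonneg v, norm_nonneg z]
  have h6 := dotProduct_laplacianL_self_nonpos (v + z)
  rw [e]
  calc _ ≤ M * (‖z‖ * ((2 + 2 * |γ|) * (1 + ‖v + z‖ ^ 2))) := by linarith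
    _ ≤ M * (‖z‖ * ((2 + 2 * |γ|) * (1 + (2 * ‖z‖ ^ 2 + 2 * (v ⬝ᵥ v))))) := by gcongr
    _ = _ := by ring

lemma hasDerivWithinAt_dotProduct_self {ι : Type*} [Fintype ι] {v : ℝ → ι → ℝ} {v' : ι → ℝ}
    {s : Set ℝ} {t : ℝ} (hv : HasDerivWithinAt v v' s t) :
    HasDerivWithinAt (fun t => v t ⬝ᵥ v t) (2 * (v t ⬝ᵥ v')) s t := by
  have h := hasDerivWithinAt_pi.1 hv
  have := HasDerivWithinAt.fun_sum (u := Finset.univ) fun i _ => (h i).fun_mul (h i)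
  refine this.congr_deriv ?_
  rw [dotProduct, Finset.mul_sum]
  exact Finset.sum_congr rfl fun _ _ => by ring

/-- Global existence for a compactly supported field shifted by a continuous path. -/
lemma exists_hasDerivWithinAt_of_hasCompactSupport {E : Type*} [NormedAddCommGroup E]
    [NormedSpace ℝ E] [CompleteSpace E] {c : E → E} {K : ℝ≥0}
    (hc : HasCompactSupport c) (hK : LipschitzWith K c) {Z : ℝ → E} (hZ : Continuous Z) (x₀ : E)
    (T : ℝ≥0) :
    ∃ v : ℝ → E, v 0 = x₀ ∧
      ∀ t ∈ Icc (0 : ℝ) T, HasDerivWithinAt v (c (v t + Z t)) (Icc 0 T) t := by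
  obtain ⟨L, hL⟩ := hc.exists_bound_of_continuous hK.continuous
  have hL0 : 0 ≤ L := (norm_nonneg _).trans (hL 0)
  -- At speed at most `L` the solution stays within distance `L * T` of `x₀`, so the local theorem
  -- covers all of `[0, T]`.
  have hpl : IsPicardLindelof (fun t y => c (y + Z t)) (⟨0, by simp⟩ : Icc (0 : ℝ) T) x₀
      (L.toNNReal * T) 0 L.toNNReal K :=
    { lipschitzOnWith := fun t _ => by
        refine LipschitzWith.lipschitzOnWith (LipschitzWith.of_dist_le_mul fun x y => ?_)
        simpa using hK.dist_le_mul (x + Z t) (y + Z t)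
      continuousOn := fun x _ =>
        (hK.continuous.comp (continuous_const.add hZ)).continuousOn
      norm_le := fun t _ x _ => by rw [Real.coe_toNNReal _ hL0]; exact hL _
      mul_max_le := by simp }
  exact hpl.exists_eq_forall_mem_Icc_hasDerivWithinAt₀

/-- Solutions of the truncated equation stay bounded, uniformly in the truncation. -/
lemma dotProduct_self_le_gronwallBound (γ : ℝ) {v Z : ℝ → ZMod M → ℝ} {x₀ : ZMod M → ℝ}
    {T : ℝ≥0} {R : ℝ≥0} {S : ℝ} (hS : ∀ t ∈ Icc (0 : ℝ) T, ‖Z t‖ ≤ S) (hv0 : v 0 = x₀)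
    (hv : ∀ t ∈ Icc (0 : ℝ) T,
      HasDerivWithinAt v (cutoff R (v t + Z t) • drift γ (v t + Z t)) (Icc 0 T) t) :
    ∀ t ∈ Icc (0 : ℝ) T, v t ⬝ᵥ v t ≤
      gronwallBound (x₀ ⬝ᵥ x₀) (4 * (M * S * (2 + 2 * |γ|)))
        (2 * (M * S * (2 + 2 * |γ|)) * (1 + 2 * S ^ 2)) T := by
  intro t ht
  have hS0 : 0 ≤ S := (norm_nonneg _).trans (hS 0 ⟨le_rfl, T.2⟩)
  set A := M * S * (2 + 2 * |γ|) with hA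
  have hA0 : 0 ≤ A := by positivity
  have hx0 := dotProduct_self_nonneg' x₀
  refine (le_gronwallBound_of_liminf_deriv_right_le (f := fun t => v t ⬝ᵥ v t)
    (f' := fun t => 2 * (v t ⬝ᵥ (cutoff R (v t + Z t) • drift γ (v t + Z t))))
    (δ := x₀ ⬝ᵥ x₀) (K := 4 * A) (ε := 2 * A * (1 + 2 * S ^ 2)) (a := 0) (b := T)
    ?_ ?_ ?_ ?_ t ht).trans ?_
  · exact fun s hs => (hasDerivWithinAt_dotProduct_self (hv s hs)).continuousWithinAt
  · intro s hs r hr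
    have h1 : HasDerivWithinAt v (cutoff R (v s + Z s) • drift γ (v s + Z s)) (Ici s) s :=
      (hv s (Ico_subset_Icc_self hs)).mono_of_mem_nhdsWithin
        (mem_of_superset (Icc_mem_nhdsGE hs.2) (Icc_subset_Icc_left hs.1))
    have h2 := (hasDerivWithinAt_dotProduct_self h1).liminf_right_slope_le hr
    simpa [slope_def_field, div_eq_inv_mul] using h2
  · rw [hv0]
  · intro s hs
    have h1 := dotProduct_drift_le γ (v s) (Z s)
    have h2 := hS s (Ico_subset_Icc_self hs)
    have h3 := dotProduct_self_nonneg' (v s)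
    have h4 : M * ‖Z s‖ * (2 + 2 * |γ|) * (1 + 2 * ‖Z s‖ ^ 2 + 2 * (v s ⬝ᵥ v s))
        ≤ A * (1 + 2 * S ^ 2 + 2 * (v s ⬝ᵥ v s)) := by
      rw [hA]; gcongr
    have h5 : 0 ≤ A * (1 + 2 * S ^ 2 + 2 * (v s ⬝ᵥ v s)) := by positivity
    have h6 := cutoff_nonneg R (v s + Z s)
    have h7 := cutoff_le_one R (v s + Z s)
    rw [dotProduct_smul, smul_eq_mul]
    nlinarith
  · rw [sub_zero]
    exact gronwallBound_mono hx0 (by positivity) (by positivity) ht.2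

lemma dotProduct_self_le_card_mul (x : ZMod M → ℝ) : x ⬝ᵥ x ≤ M * ‖x‖ ^ 2 := by
  refine (Finset.sum_le_card_nsmul _ _ (‖x‖ ^ 2) fun j _ => ?_).trans_eq ?_
  · rw [← sq, ← sq_abs]
    exact pow_le_pow_left₀ (abs_nonneg _) (norm_le_pi_norm x j) 2
  · rw [Finset.card_univ, ZMod.card, nsmul_eq_mul]

/-- The Sasamoto-Spohn equation along a continuous path has a solution on every bounded
interval. -/
lemma exists_solvesOn (γ : ℝ) {X : ℝ≥0 → ZMod M → ℝ} (hX : Continuous X)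
    (x₀ : ZMod M → ℝ) (T : ℝ≥0) :
    ∃ u : ℝ≥0 → ZMod M → ℝ, Continuous u ∧ SolvesOn (fun x => γ • nonlinearity x) X x₀ T u := by
  set Z : ℝ → ZMod M → ℝ := fun t => backwardDiff M (X t.toNNReal) with hZ
  have hZc : Continuous Z := by fun_prop
  obtain ⟨S, hS⟩ := (isCompact_Icc (a := (0 : ℝ)) (b := T)).exists_bound_of_continuousOn
    hZc.continuousOn
  set G := gronwallBound (x₀ ⬝ᵥ x₀) (4 * (M * S * (2 + 2 * |γ|)))
    (2 * (M * S * (2 + 2 * |γ|)) * (1 + 2 * S ^ 2)) T with hG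
  -- Since `G` does not depend on the radius, `R` can be chosen afterwards to dominate `|v + Z|² ≤
  -- 2|v|² + 2|Z|²`, so that the cutoff is never active.
  set R : ℝ≥0 := (2 * G + 2 * (M * S ^ 2)).toNNReal with hR
  have hcd : ContDiff ℝ 1 fun x : ZMod M → ℝ => cutoff R x • drift γ x :=
    (contDiff_cutoff R (n := 1)).smul (contDiff_drift γ)
  have hcs : HasCompactSupport fun x : ZMod M → ℝ => cutoff R x • drift γ x :=
    (hasCompactSupport_cutoff R).smul_right
  obtain ⟨K, hK⟩ := hcd.lipschitzWith_of_hasCompactSupport hcs one_ne_zero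
  obtain ⟨v, hv0, hv⟩ := exists_hasDerivWithinAt_of_hasCompactSupport hcs hK hZc x₀ T
  have hvG := dotProduct_self_le_gronwallBound γ hS hv0 hv
  have hcut (t : ℝ) (ht : t ∈ Icc (0 : ℝ) T) : cutoff R (v t + Z t) = 1 := by
    refine cutoff_eq_one ?_
    have h1 := hvG t ht
    have h2 : Z t ⬝ᵥ Z t ≤ M * S ^ 2 := (dotProduct_self_le_card_mul _).trans (by
      have := hS t ht
      gcongr)
    have h3 := dotProduct_self_nonneg' (v t - Z t)
    have h4 : (v t + Z t) ⬝ᵥ (v t + Z t) ≤ 2 * (v t ⬝ᵥ v t) + 2 * (Z t ⬝ᵥ Z t) := by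
      simp only [add_dotProduct, dotProduct_add, sub_dotProduct, dotProduct_sub] at h3 ⊢
      linarith
    exact (h4.trans (by linarith)).trans (Real.le_coe_toNNReal _)
  have hvc : ContinuousOn v (Icc 0 T) := fun t ht => (hv t ht).continuousWithinAt
  -- Freezing `v` after time `T` gives a path continuous on the whole half-line.
  have hmin : Continuous fun s : ℝ≥0 => v (min s T : ℝ≥0) :=
    hvc.comp_continuous (by fun_prop) fun s => ⟨by positivity, by simp⟩
  refine ⟨fun s => v (min s T : ℝ≥0) + Z s, hmin.add (hZc.comp NNReal.continuous_coe),
    fun t ht => ?_⟩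
  have htT : (t : ℝ) ≤ T := ht
  have hsub : Icc (0 : ℝ) t ⊆ Icc 0 T := Icc_subset_Icc_right htT
  have hint : ∫ s in (0 : ℝ)..t, drift γ (v s + Z s) = v t - v 0 := by
    have hcont : ContinuousOn (fun s => drift γ (v s + Z s)) (Icc 0 t) :=
      (contDiff_drift γ (n := 1)).continuous.comp_continuousOn
        ((hvc.mono hsub).add hZc.continuousOn)
    refine intervalIntegral.integral_eq_sub_of_hasDerivAt_of_le t.2 (hvc.mono hsub)
      (fun s hs => ?_) (hcont.intervalIntegrable_of_Icc t.2)
    have h1 := hv s (hsub (Ioo_subset_Icc_self hs))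
    rw [hcut s (hsub (Ioo_subset_Icc_self hs)), one_smul] at h1
    exact h1.hasDerivAt (Icc_mem_nhds hs.1 (hs.2.trans_le htT))
  have hcongr : ∫ s in (0 : ℝ)..t, ((1 / 2 : ℝ) • laplacianL M
        (v (min s.toNNReal T : ℝ≥0) + Z s.toNNReal)
          + γ • nonlinearity (v (min s.toNNReal T : ℝ≥0) + Z s.toNNReal))
      = ∫ s in (0 : ℝ)..t, drift γ (v s + Z s) := by
    refine intervalIntegral.integral_congr fun s hs => ?_
    rw [uIcc_of_le t.coe_nonneg] at hs
    have h1 : ((min s.toNNReal T : ℝ≥0) : ℝ) = s := by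
      rw [min_eq_left (Real.toNNReal_le_iff_le_coe.2 (hs.2.trans htT)), Real.coe_toNNReal _ hs.1]
    simp only [h1, Real.coe_toNNReal _ hs.1, drift_eq]
  change v (min t T : ℝ≥0) + Z t = _
  rw [hcongr, hint, hv0, min_eq_left ht]
  simp [hZ]

/-- The nonlinear part of the drift, truncated outside a ball. -/
noncomputable def truncatedNonlinearity (M : ℕ) [NeZero M] (γ : ℝ) (R : ℝ≥0) (x : ZMod M → ℝ) :
    ZMod M → ℝ :=
  cutoff R x • γ • nonlinearity x

lemma isConservative_truncatedNonlinearity (γ : ℝ) (R : ℝ≥0) :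
    IsConservative (truncatedNonlinearity M γ R) := by
  refine isConservative_cutoff_smul R (contDiff_nonlinearity.const_smul γ) (fun x => ?_)
    fun x => ?_
  · rw [dotProduct_smul, dotProduct_nonlinearity_self, smul_zero]
  · have hd := contDiff_nonlinearity (M := M) (n := 1) |>.differentiable one_ne_zero x
    have := divergence_nonlinearity x
    rw [divergence] at this ⊢
    rw [fderiv_fun_const_smul hd]
    simp [← Finset.mul_sum, this]

/-- A solution on a bounded interval solves the truncated equations for large radii. -/
lemma SolvesOn.eventually_truncated {γ : ℝ} {X : ℝ≥0 → ZMod M → ℝ} {x₀ : ZMod M → ℝ} {T : ℝ≥0}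
    {u : ℝ≥0 → ZMod M → ℝ} (hu : SolvesOn (fun x => γ • nonlinearity x) X x₀ T u)
    (huc : Continuous u) :
    ∀ᶠ R : ℕ in atTop, SolvesOn (truncatedNonlinearity M γ R) X x₀ T u := by
  have hq : Continuous fun t => u t ⬝ᵥ u t := by unfold dotProduct; fun_prop
  obtain ⟨C, hC⟩ := (isCompact_Icc (a := (0 : ℝ≥0)) (b := T)).exists_bound_of_continuousOn
    hq.continuousOn
  filter_upwards [eventually_ge_atTop ⌈C⌉₊] with R hR
  intro t ht
  conv_lhs => rw [hu t ht]
  congr 2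
  refine intervalIntegral.integral_congr fun s hs => ?_
  rw [uIcc_of_le t.coe_nonneg] at hs
  have h1 : s.toNNReal ≤ T := Real.toNNReal_le_iff_le_coe.2 (hs.2.trans ht)
  have h2 := (le_abs_self _).trans (hC s.toNNReal ⟨zero_le, h1⟩)
  have h3 : cutoff (R : ℝ≥0) (u s.toNNReal) = 1 :=
    cutoff_eq_one (h2.trans ((Nat.le_ceil C).trans (by exact_mod_cast hR)))
  simp only [truncatedNonlinearity, h3, one_smul]

/-- The truncated splitting schemes converge to the solution of the equation. -/
lemma SolvesOn.eventually_tendsto_scheme {γ : ℝ} {X : ℝ≥0 → ZMod M → ℝ} {x₀ : ZMod M → ℝ}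
    {T : ℝ≥0} {u : ℝ≥0 → ZMod M → ℝ} (hu : SolvesOn (fun x => γ • nonlinearity x) X x₀ T u)
    (huc : Continuous u) (hX0 : X 0 = 0) :
    ∀ᶠ R : ℕ in atTop, Tendsto (fun N : ℕ =>
      scheme (truncatedNonlinearity M γ R) (T / N) x₀ (increment X (T / N)) N) atTop
        (𝓝 (u T)) := by
  filter_upwards [hu.eventually_truncated huc] with R hR
  have hb := isConservative_truncatedNonlinearity (M := M) γ R
  obtain ⟨K, hK⟩ := hb.exists_lipschitzWith
  obtain ⟨B, hB⟩ := hb.hasCompactSupport.exists_bound_of_continuous hK.continuous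
  exact hR.tendsto_scheme huc hX0 hK hB

/-- For one large radius both solutions are limits of the same scheme. -/
lemma SolvesOn.unique {γ : ℝ} {X : ℝ≥0 → ZMod M → ℝ} {x₀ : ZMod M → ℝ} {T : ℝ≥0}
    {u u' : ℝ≥0 → ZMod M → ℝ} (hu : SolvesOn (fun x => γ • nonlinearity x) X x₀ T u)
    (huc : Continuous u) (hu' : SolvesOn (fun x => γ • nonlinearity x) X x₀ T u')
    (huc' : Continuous u') (hX0 : X 0 = 0) : u T = u' T := by
  obtain ⟨R, h1, h2⟩ := ((hu.eventually_tendsto_scheme huc hX0).and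
    (hu'.eventually_tendsto_scheme huc' hX0)).exists
  exact tendsto_nhds_unique h1 h2

/-- The Sasamoto-Spohn equation along a continuous path has a global solution. -/
theorem exists_forall_solvesOn (γ : ℝ) {X : ℝ≥0 → ZMod M → ℝ} (hX : Continuous X) (hX0 : X 0 = 0)
    (x₀ : ZMod M → ℝ) :
    ∃ u : ℝ≥0 → ZMod M → ℝ, Continuous u ∧
      ∀ T, SolvesOn (fun x => γ • nonlinearity x) X x₀ T u := by
  choose U hUc hU using fun n : ℕ => exists_solvesOn γ hX x₀ n
  set u : ℝ≥0 → ZMod M → ℝ := fun t => U (⌈t⌉₊) t with hu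
  have hagree (n : ℕ) (t : ℝ≥0) (ht : t ≤ n) : u t = U n t :=
    ((hU ⌈t⌉₊).mono (Nat.le_ceil t)).unique (hUc _) ((hU n).mono ht) (hUc n) hX0
  refine ⟨u, continuous_iff_continuousAt.2 fun t => ?_, fun T t ht => ?_⟩
  · obtain ⟨n, hn⟩ := exists_nat_gt t
    refine (hUc n).continuousAt.congr ?_
    filter_upwards [Iio_mem_nhds hn] with s hs using (hagree n s (le_of_lt hs)).symm
  · obtain ⟨n, hn⟩ := exists_nat_gt t
    rw [hagree n t hn.le, hU n t hn.le]
    congr 2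
    refine intervalIntegral.integral_congr fun s hs => ?_
    rw [uIcc_of_le t.coe_nonneg] at hs
    have h1 : s.toNNReal ≤ n := (Real.toNNReal_le_iff_le_coe.2 hs.2).trans hn.le
    simp only [hagree n _ h1]

end Existence

/-! ### Measurability and expectations under iterated limits. -/

section IteratedLimits

variable {Ω : Type*} [MeasurableSpace Ω] {P : Measure Ω}

/-- For small `R` the inner limit need not exist. Iterated limsups in `EReal` always exist, are
measurable, and agree with the limit coordinatewise almost surely. -/
lemma aemeasurable_of_eventually_tendsto {ι : Type*} [Finite ι] {Z : ℕ → ℕ → Ω → ι → ℝ}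
    {Y : Ω → ι → ℝ} (hZ : ∀ R N, AEMeasurable (Z R N) P)
    (h : ∀ᵐ ω ∂P, ∀ᶠ R in atTop, Tendsto (fun N => Z R N ω) atTop (𝓝 (Y ω))) :
    AEMeasurable Y P := by
  refine aemeasurable_pi_iff.2 fun i => ?_
  refine ⟨fun ω => (limsup (fun R => limsup (fun N => (((hZ R N).mk _ ω i : ℝ) : EReal)) atTop)
    atTop).toReal, ?_, ?_⟩
  · refine Measurable.ereal_toReal (Measurable.limsup fun R => Measurable.limsup fun N => ?_)
    exact ((measurable_pi_apply i).comp (hZ R N).measurable_mk).coe_real_ereal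
  · have hmk : ∀ᵐ ω ∂P, ∀ R N, Z R N ω = (hZ R N).mk _ ω :=
      ae_all_iff.2 fun R => ae_all_iff.2 fun N => (hZ R N).ae_eq_mk
    filter_upwards [h, hmk] with ω h1 h2
    have h3 : (fun R => limsup (fun N => (((hZ R N).mk _ ω i : ℝ) : EReal)) atTop)
        =ᶠ[atTop] fun _ => ((Y ω i : ℝ) : EReal) := by
      filter_upwards [h1] with R hR
      simp_rw [← h2]
      exact ((continuous_coe_real_ereal.tendsto _).comp (tendsto_pi_nhds.1 hR i)).limsup_eq
    rw [limsup_congr h3, limsup_const, EReal.toReal_coe]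

/-- The radius from which convergence holds depends on `ω`. Reverse Fatou in `N` bounds the error by
`∫⁻ L R`, and dominated convergence in `R` sends this to zero; `c` is the same for every `R`. -/
lemma integral_eq_of_eventually_tendsto {E : Type*} [TopologicalSpace E] [MeasurableSpace E]
    [OpensMeasurableSpace E] [IsProbabilityMeasure P] {Z : ℕ → ℕ → Ω → E} {Y : Ω → E} {c : ℝ}
    (hZ : ∀ R N, AEMeasurable (Z R N) P) (hY : AEMeasurable Y P)
    (h : ∀ᵐ ω ∂P, ∀ᶠ R in atTop, Tendsto (fun N => Z R N ω) atTop (𝓝 (Y ω)))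
    {f : E → ℝ} (hf : Continuous f) (hf1 : ∀ x, |f x| ≤ 1)
    (hc : ∀ R, Tendsto (fun N => ∫ ω, f (Z R N ω) ∂P) atTop (𝓝 c)) :
    ∫ ω, f (Y ω) ∂P = c := by
  have hfY : AEMeasurable (fun ω => f (Y ω)) P := hf.measurable.comp_aemeasurable hY
  have hfZ (R N : ℕ) : AEMeasurable (fun ω => f (Z R N ω)) P :=
    hf.measurable.comp_aemeasurable (hZ R N)
  have hg (R N : ℕ) : AEMeasurable (fun ω => ‖f (Y ω) - f (Z R N ω)‖ₑ) P :=
    (hfY.sub (hfZ R N)).enorm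
  have hmk : ∀ᵐ ω ∂P, ∀ R N, ‖f (Y ω) - f (Z R N ω)‖ₑ = (hg R N).mk _ ω :=
    ae_all_iff.2 fun R => ae_all_iff.2 fun N => (hg R N).ae_eq_mk
  have hbound (x y : E) : ‖f x - f y‖ₑ ≤ 2 := by
    rw [← ofReal_norm, ← ENNReal.ofReal_ofNat 2]
    refine ENNReal.ofReal_le_ofReal ((norm_sub_le _ _).trans ?_)
    have h1 := hf1 x
    have h2 := hf1 y
    simp only [Real.norm_eq_abs]
    linarith
  set L : ℕ → Ω → ENNReal := fun R ω => limsup (fun N => (hg R N).mk _ ω) atTop with hL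
  have hLm (R : ℕ) : Measurable (L R) := Measurable.limsup fun N => (hg R N).measurable_mk
  have hle (R : ℕ) : ‖(∫ ω, f (Y ω) ∂P) - c‖ₑ ≤ ∫⁻ ω, L R ω ∂P := by
    have h1 : Tendsto (fun N => ‖(∫ ω, f (Y ω) ∂P) - ∫ ω, f (Z R N ω) ∂P‖ₑ) atTop
        (𝓝 ‖(∫ ω, f (Y ω) ∂P) - c‖ₑ) := (tendsto_const_nhds.sub (hc R)).enorm
    rw [← h1.limsup_eq]
    refine le_trans (limsup_le_limsup (Eventually.of_forall fun N => ?_))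
      (limsup_lintegral_le (fun _ => 2) (fun N => (hg R N).measurable_mk) (fun N => ?_) (by simp))
    · have hi {V : Ω → ℝ} (hV : AEMeasurable V P) (hV1 : ∀ ω, |V ω| ≤ 1) : Integrable V P :=
        Integrable.of_bound hV.aestronglyMeasurable 1 (ae_of_all _ hV1)
      beta_reduce
      rw [← integral_sub (hi hfY fun _ => hf1 _) (hi (hfZ R N) fun _ => hf1 _),
        ← lintegral_congr_ae (hg R N).ae_eq_mk]
      exact enorm_integral_le_lintegral_enorm _
    · filter_upwards [hmk] with ω hω
      rw [← hω R N]
      exact hbound _ _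
  have hlim : Tendsto (fun R => ∫⁻ ω, L R ω ∂P) atTop (𝓝 (∫⁻ _, 0 ∂P)) := by
    refine tendsto_lintegral_of_dominated_convergence (fun _ => 2) hLm (fun R => ?_) (by simp) ?_
    · filter_upwards [hmk] with ω hω
      refine limsup_le_of_le (by isBoundedDefault) (Eventually.of_forall fun N => ?_)
      rw [← hω R N]
      exact hbound _ _
    · filter_upwards [h, hmk] with ω h1 h2
      refine tendsto_const_nhds.congr' ?_
      filter_upwards [h1] with R hR
      have h3 : Tendsto (fun N => ‖f (Y ω) - f (Z R N ω)‖ₑ) atTop (𝓝 0) := by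
        have := (tendsto_const_nhds (x := f (Y ω))).sub ((hf.tendsto _).comp hR) |>.enorm
        simpa using this
      simp only [hL, ← h2]
      exact h3.limsup_eq.symm
  rw [lintegral_zero] at hlim
  have h0 : ‖(∫ ω, f (Y ω) ∂P) - c‖ₑ = 0 :=
    le_antisymm (ge_of_tendsto' hlim hle) zero_le
  exact sub_eq_zero.1 (enorm_eq_zero.1 h0)

/-- A probability measure is determined by the integrals of continuous functions bounded by one. -/
lemma ext_of_integral_of_abs_le_one {E : Type*} [TopologicalSpace E] [MeasurableSpace E]
    [BorelSpace E] [HasOuterApproxClosed E] {μ ν : Measure E} [IsFiniteMeasure μ]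
    [IsFiniteMeasure ν]
    (h : ∀ f : E → ℝ, Continuous f → (∀ x, |f x| ≤ 1) → ∫ x, f x ∂μ = ∫ x, f x ∂ν) : μ = ν := by
  refine ext_of_forall_integral_eq_of_IsFiniteMeasure fun f => ?_
  have hpos : 0 < ‖f‖ + 1 := by positivity
  have := h (fun x => (‖f‖ + 1)⁻¹ * f x) (by fun_prop) fun x => by
    rw [abs_mul, abs_of_pos (inv_pos.2 hpos), inv_mul_le_one₀ hpos]
    linarith [f.norm_coe_le_norm x, Real.norm_eq_abs (f x)]
  rw [integral_const_mul, integral_const_mul] at this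
  exact mul_left_cancel₀ (inv_pos.2 hpos).ne' this

end IteratedLimits

/-! ### Existence of solutions and invariance of the Gaussian measure. -/

section Invariance

variable {M : ℕ} [NeZero M] {γ : ℝ}

lemma solvesOn_iff {X : ℝ≥0 → ZMod M → ℝ} {x₀ : ZMod M → ℝ} {T : ℝ≥0} {u : ℝ≥0 → ZMod M → ℝ}
    (hu : Continuous u) :
    SolvesOn (fun x => γ • nonlinearity x) X x₀ T u ↔ ∀ t ≤ T, ∀ j, u t j
      = x₀ j + (∫ s in (0 : ℝ)..t, drift γ (u s.toNNReal) j) + (X t j - X t (j - 1)) := by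
  refine forall₂_congr fun t _ => ?_
  rw [funext_iff]
  refine forall_congr' fun j => ?_
  have hc : Continuous fun s : ℝ => drift γ (u s.toNNReal) :=
    (contDiff_drift γ (n := 1)).continuous.comp (by fun_prop)
  have h := (ContinuousLinearMap.proj (R := ℝ)
    (φ := fun _ : ZMod M => ℝ) j).intervalIntegral_comp_comm
    (hc.intervalIntegrable (μ := volume) 0 t)
  simp only [ContinuousLinearMap.proj_apply] at h
  simp only [← drift_eq, Pi.add_apply, backwardDiff_apply, h]

variable {Ω : Type*} [MeasurableSpace Ω] {P : Measure Ω} {ξ : ZMod M → ℝ≥0 → Ω → ℝ}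
  {X₀ : Ω → ZMod M → ℝ} {u : ℝ≥0 → Ω → ZMod M → ℝ}

lemma IsNoise.ae_continuous (hξ : IsNoise ξ P) :
    ∀ᵐ ω ∂P, Continuous (fun t j => ξ j t ω) ∧ (fun j => ξ j 0 ω) = 0 := by
  filter_upwards [ae_all_iff.2 fun j => (hξ.isBrownian j).cont,
    ae_all_iff.2 fun j => (hξ.isBrownian j).eval_zero_ae_eq_zero] with ω h1 h2
  exact ⟨continuous_pi h1, funext h2⟩

/-- The splitting scheme with `N` steps on `[0, t]` for the equation truncated at radius `R`. -/
noncomputable def truncatedScheme (γ : ℝ) (ξ : ZMod M → ℝ≥0 → Ω → ℝ) (X₀ : Ω → ZMod M → ℝ)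
    (t : ℝ≥0) (R N : ℕ) (ω : Ω) : ZMod M → ℝ :=
  scheme (truncatedNonlinearity M γ R) (t / N) (X₀ ω) (fun k => noiseIncrement ξ (t / N) k ω) N

lemma ae_eventually_tendsto_truncatedScheme (hξ : IsNoise ξ P)
    (hu : ∀ᵐ ω ∂P, Continuous (fun t => u t ω) ∧
      ∀ T, SolvesOn (fun x => γ • nonlinearity x) (fun t j => ξ j t ω) (X₀ ω) T fun t => u t ω)
    (t : ℝ≥0) :
    ∀ᵐ ω ∂P, ∀ᶠ R in atTop,
      Tendsto (fun N => truncatedScheme γ ξ X₀ t R N ω) atTop (𝓝 (u t ω)) := by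
  filter_upwards [hu, hξ.ae_continuous] with ω h1 h2
  exact (h1.2 t).eventually_tendsto_scheme h1.1 h2.2

lemma aemeasurable_truncatedScheme (hξ : IsNoise ξ P) (hX₀ : AEMeasurable X₀ P) (t : ℝ≥0)
    (R N : ℕ) : AEMeasurable (truncatedScheme γ ξ X₀ t R N) P :=
  aemeasurable_scheme (isConservative_truncatedNonlinearity γ R).contDiff.continuous hξ hX₀ _ _

/-- The `N` steps contribute `C (t / N)²` each, in total `C t² / N`. -/
lemma tendsto_integral_truncatedScheme [IsProbabilityMeasure P] (hξ : IsNoise ξ P)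
    (hX₀ : HasLaw X₀ (gaussianVector (ZMod M) 1) P)
    (hindep : IndepFun X₀ (fun ω (j : ZMod M) (t : ℝ≥0) => ξ j t ω) P) (t : ℝ≥0) (R : ℕ)
    {f : (ZMod M → ℝ) → ℝ} (hf : Measurable f) (hf1 : ∀ x, |f x| ≤ 1) :
    Tendsto (fun N => ∫ ω, f (truncatedScheme γ ξ X₀ t R N ω) ∂P) atTop
      (𝓝 (∫ x, f x ∂gaussianVector (ZMod M) 1)) := by
  have hb := isConservative_truncatedNonlinearity (M := M) γ R
  obtain ⟨C, h₀, hh₀, hC⟩ := hb.exists_abs_integral_euler_sub_le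
  have hlim : Tendsto (fun N : ℕ => (t : ℝ) / N) atTop (𝓝 0) :=
    tendsto_const_div_atTop_nhds_zero_nat _
  rw [tendsto_iff_norm_sub_tendsto_zero]
  have hlim2 : Tendsto (fun N : ℕ => C * t * ((t : ℝ) / N)) atTop (𝓝 0) := by
    simpa using hlim.const_mul (C * t)
  refine squeeze_zero' (Eventually.of_forall fun _ => norm_nonneg _) ?_ hlim2
  filter_upwards [hlim.eventually_le_const hh₀, eventually_gt_atTop 0] with N h1 hN
  have hcast : ((t / N : ℝ≥0) : ℝ) = (t : ℝ) / N := by push_cast; rfl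
  refine (abs_integral_scheme_sub_le hb.contDiff.continuous (hC (t / N) (by rwa [hcast])) hξ hX₀
    hindep N hf hf1).trans_eq ?_
  have : (N : ℝ) ≠ 0 := by exact_mod_cast hN.ne'
  rw [hcast]
  field_simp

lemma IsSolution.ae_solvesOn (hu : IsSolution γ ξ X₀ u P) :
    ∀ᵐ ω ∂P, Continuous (fun t => u t ω) ∧
      ∀ T, SolvesOn (fun x => γ • nonlinearity x) (fun t j => ξ j t ω) (X₀ ω) T
        fun t => u t ω := by
  filter_upwards [hu.continuous, hu.equation] with ω h1 h2
  exact ⟨h1, fun T => (solvesOn_iff h1).2 fun t _ j => h2 t j⟩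

/-- Solutions are chosen separately for each `ω`, which gives no measurability; it is recovered
because they are almost surely limits of the schemes. -/
theorem exists_isSolution (γ : ℝ) (hξ : IsNoise ξ P) (hX₀ : AEMeasurable X₀ P) :
    ∃ u : ℝ≥0 → Ω → ZMod M → ℝ, IsSolution γ ξ X₀ u P := by
  have h (ω : Ω) : ∃ v : ℝ≥0 → ZMod M → ℝ,
      Continuous (fun t j => ξ j t ω) ∧ (fun j => ξ j 0 ω) = 0 → Continuous v ∧
        ∀ T, SolvesOn (fun x => γ • nonlinearity x) (fun t j => ξ j t ω) (X₀ ω) T v := by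
    by_cases hω : Continuous (fun t j => ξ j t ω) ∧ (fun j => ξ j 0 ω) = 0
    · obtain ⟨v, hv⟩ := exists_forall_solvesOn γ hω.1 hω.2 (X₀ ω)
      exact ⟨v, fun _ => hv⟩
    · exact ⟨0, fun h => absurd h hω⟩
  choose v hv using h
  have hsol : ∀ᵐ ω ∂P, Continuous (v ω) ∧
      ∀ T, SolvesOn (fun x => γ • nonlinearity x) (fun t j => ξ j t ω) (X₀ ω) T (v ω) := by
    filter_upwards [hξ.ae_continuous] with ω hω using hv ω hω
  refine ⟨fun t ω => v ω t, fun t => ?_, hsol.mono fun ω hω => hω.1, ?_⟩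
  · exact aemeasurable_of_eventually_tendsto (aemeasurable_truncatedScheme hξ hX₀ t)
      (ae_eventually_tendsto_truncatedScheme hξ hsol t)
  · filter_upwards [hsol] with ω hω t j
    exact (solvesOn_iff hω.1).1 (hω.2 t) t le_rfl j

theorem IsSolution.hasLaw [IsProbabilityMeasure P] (hu : IsSolution γ ξ X₀ u P)
    (hξ : IsNoise ξ P) (hX₀ : HasLaw X₀ (gaussianMeasure M) P)
    (hindep : IndepFun X₀ (fun ω (j : ZMod M) (t : ℝ≥0) => ξ j t ω) P) (t : ℝ≥0) :
    HasLaw (u t) (gaussianMeasure M) P := by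
  refine ⟨hu.aemeasurable t, ?_⟩
  have := Measure.isProbabilityMeasure_map (hu.aemeasurable t)
  change P.map (u t) = gaussianVector (ZMod M) 1
  refine ext_of_integral_of_abs_le_one fun f hf hf1 => ?_
  rw [integral_map (hu.aemeasurable t) hf.aestronglyMeasurable]
  exact integral_eq_of_eventually_tendsto (aemeasurable_truncatedScheme hξ hX₀.aemeasurable t)
    (hu.aemeasurable t) (ae_eventually_tendsto_truncatedScheme hξ hu.ae_solvesOn t) hf hf1
    fun R => tendsto_integral_truncatedScheme hξ hX₀ hindep t R hf.measurable hf1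

end Invariance

end SasamotoSpohn

theorem mainTheorem4 (M : ℕ) [NeZero M] (γ : ℝ)
    {Ω : Type*} [MeasurableSpace Ω] (P : Measure Ω) [IsProbabilityMeasure P]
    (ξ : ZMod M → ℝ≥0 → Ω → ℝ) (hξ : SasamotoSpohn.IsNoise ξ P)
    (X₀ : Ω → ZMod M → ℝ) (hX₀ : HasLaw X₀ (SasamotoSpohn.gaussianMeasure M) P)
    (hindep : IndepFun X₀ (fun ω (j : ZMod M) (t : ℝ≥0) => ξ j t ω) P) :
    (∃ u : ℝ≥0 → Ω → ZMod M → ℝ, SasamotoSpohn.IsSolution γ ξ X₀ u P) ∧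
    ∀ u : ℝ≥0 → Ω → ZMod M → ℝ, SasamotoSpohn.IsSolution γ ξ X₀ u P →
      ∀ t : ℝ≥0, HasLaw (u t) (SasamotoSpohn.gaussianMeasure M) P :=
  ⟨SasamotoSpohn.exists_isSolution γ hξ hX₀.aemeasurable,
    fun _ hu t => hu.hasLaw hξ hX₀ hindep t⟩
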